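/- **Setting.** Consider a one-dimensional exponential dispersion family, with densities $\exp\big((y\vartheta-F(\vartheta))/\varphi+K(y,\varphi)\big)$ with respect to a fixed reference measure, dispersion $\varphi>0$, log-normalizer $F$ and open natural parameter space $\Theta\ni 0$, and assume $0<F''(0)\le 1$. Let $\beta>0$, $0\le\kappa\le d$, $N\ge 1$, and let $x^{(1)},\dots,x^{(N)}\in\mathbb R^d$ be data with mean $\bar x$. The decoder is $\vartheta(z)=Wz+b$ with $W\in\mathbb R^{d\times\kappa}$, $b\in\mathbb R^d$; the coordinates of $x$ given $z$ are independent members of the family with parameters $\vartheta_j(z)$. Let $T_x(\vartheta)$ be the second order Taylor polynomial at $\vartheta=0$ of the log-likelihood $\sum_{j=1}^d\big[(x_j\vartheta_j-F(\vartheta_j))/\varphi+K(x_j,\varphi)\big]$. For $\mu^{(i)}\in\mathbb R^\kappa$ and positive definite $\Sigma^{(i)}\in\mathbb R^{\kappa\times\kappa}$ ($i=1,\dots,N$) put $$\widehat{\mathcal L}(W,b,\mu,\Sigma)=\frac1N\sum_{i=1}^N\Big(\mathbb E_{Z\sim\mathcal N(\mu^{(i)},\Sigma^{(i)})}\big[T_{x^{(i)}}(WZ+b)\big]-\beta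 D_{KL}\big(\mathcal N(\mu^{(i)},\Sigma^{(i)})\,\|\,\mathcal N(0,I_\kappa)\big)\Big).$$ Let $t^{(i)}=F''(0)^{-1}(x^{(i)}-F'(0))$ (with $F'(0)$ subtracted from every coordinate), $C=F''(0)^{-1}\varphi I_d+\beta^{-1}WW^T$, $S=\frac1N\sum_i(t^{(i)}-b)(t^{(i)}-b)^T$, and define the approximate objective $$\widehat{\mathcal L}(W,b)=-\tfrac12\Big(\operatorname{tr}(C^{-1}S)+\beta\log|C|+\beta d\log(\varphi^{-1}F''(0))+D(\varphi)\Big),$$ $$D(\varphi)=\frac{2d}{\varphi}F(0)-\frac1N\sum_{i=1}^N\Big[\frac{1}{F''(0)\varphi}\|x^{(i)}-F'(0)\|_2^2+2\sum_{j=1}^dK(x_j^{(i)},\varphi)\Big].$$ Put $\hat b=\frac1N\sum_i t^{(i)}$, let $\hat S$ be $S$ at $b=\hat b$ (the sample covariance), with eigenvalues $\lambda_1\ge\dots\ge\lambda_d$, and let $c=\beta F''(0)^{-1}\varphi$ be the cut-off. Let $k_j=\lambda_j$ if $\lambda_j\ge c$ and $k_j=c$ otherwise, $K_\kappa=\operatorname{diag}(k_1,\dots,k_\kappa)$,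 $L=(K_\kappa-cI_\kappa)^{1/2}$. A matrix $U_\kappa\in\mathbb R^{d\times\kappa}$ is called admissible if its columns are orthonormal eigenvectors of $\hat S$ for $\lambda_1,\dots,\lambda_\kappa$, in this order. **Theorem.** 1. For all $W,b$, $\widehat{\mathcal L}(W,b)$ is the maximum of $\widehat{\mathcal L}(W,b,\mu,\Sigma)$ over all $\mu^{(i)}$ and all positive definite $\Sigma^{(i)}$. 2. Admissible $U_\kappa$ exist. For every admissible $U_\kappa$ and every orthogonal $R\in\mathbb R^{\kappa\times\kappa}$, the pair $\hat W=U_\kappa LR$, $\hat b$ maximizes $\widehat{\mathcal L}(W,b)$ over $\mathbb R^{d\times\kappa}\times\mathbb R^d$. Conversely, every maximizer $(W,b)$ satisfies $b=\hat b$ and $W=U_\kappa LR$ for some admissible $U_\kappa$ and some $R$ with $R^TR=I_\kappa$, $\det R=1$. 3. For each such $\hat W=U_\kappa LR$ and $\hat b$, the unique maximizer of $\widehat{\mathcal L}(\hat W,\hat b,\mu,\Sigma)$ over the variational parameters is given, for all $i$, by $\Sigma^{(i)}=\hat\Sigma_z$ and $\mu^{(i)}=\hat\mu_z^{(i)}$,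 where $$\hat\Sigma_z=\frac{\beta\varphi}{F''(0)}R^TK_\kappa^{-1}R\succ0,\qquad \hat\mu_z^{(i)}=\frac1{\beta\varphi}\hat\Sigma_z\hat W^T(x^{(i)}-\bar x)=R^TK_\kappa^{-1}LU_\kappa^T\frac1{F''(0)}(x^{(i)}-\bar x).$$ 4. (Auto-pruning.) The $j$-th column of $\hat WR^T$ is zero if and only if $\lambda_j\le c$, and $\operatorname{rank}\hat W=\#\{j\le\kappa:\lambda_j>c\}$. 5. (Posterior collapse.) If $\lambda_j\le c$ for all $j\le\kappa$ (that is, if $\beta$ is large enough), then $\hat W=0$, $\hat\Sigma_z=I_\kappa$ and $\hat\mu_z^{(i)}=0$ for all $i$. -/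

import Mathlib

open MeasureTheory ProbabilityTheory InformationTheory Matrix

noncomputable section

namespace BetaVAE

/-- A one-dimensional exponential dispersion family with dispersion `φ`: with respect to the
reference measure `base` (Lebesgue measure in the continuous case, counting measure on the support
in the discrete case) the member with location parameter `ϑ` has the log-density
`(y * ϑ - F ϑ) / φ + K y φ`. -/
structure EDF where
  /-- reference measure -/
  base : Measure ℝ
  /-- log-normalizer -/
  F : ℝ → ℝ
  K : ℝ → ℝ → ℝ
  /-- dispersion parameter -/
  φ : ℝ
  φ_pos : 0 < φ
  /-- the natural parameter space is open (it is automatically convex) -/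
  isOpen_param : IsOpen {ϑ : ℝ | Integrable (fun y => Real.exp (y * ϑ / φ + K y φ)) base}
  /-- `F` normalizes the densities -/
  integral_eq_one : ∀ ϑ : ℝ, Integrable (fun y => Real.exp (y * ϑ / φ + K y φ)) base →
    ∫ y, Real.exp ((y * ϑ - F ϑ) / φ + K y φ) ∂base = 1

namespace EDF

variable (E : EDF)

/-- The natural parameter space `Θ`. -/
def paramSpace : Set ℝ := {ϑ : ℝ | Integrable (fun y => Real.exp (y * ϑ / E.φ + E.K y E.φ)) E.base}

/-- `F(0)` -/
def F0 : ℝ := E.F 0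

/-- `F'(0)` -/
def F1 : ℝ := deriv E.F 0

/-- `F''(0)` -/
def F2 : ℝ := iteratedDeriv 2 E.F 0

/-- The decoder log-likelihood `log P_ϑ(x)` of an observation `x ∈ ℝᵈ` whose coordinates are
independent, the `j`-th one having location parameter `ϑ j`. -/
def logLik {d : ℕ} (x ϑ : Fin d → ℝ) : ℝ :=
  ∑ j, ((x j * ϑ j - E.F (ϑ j)) / E.φ + E.K (x j) E.φ)

/-- The second order Taylor polynomial of `ϑ ↦ log P_ϑ(x)` at `ϑ = 0`. As `x j * ϑ j` is linear in
`ϑ`, this amounts to replacing `F` by its second order Taylor polynomial at `0`.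

For an affine `ϑ(z) = W z + b`, the function `z ↦ logLikTaylor x (ϑ(z))` is the second order Taylor
polynomial of `z ↦ log P_{ϑ(z)}(x)` at any `z₀` with `ϑ(z₀) = 0`. -/
def logLikTaylor {d : ℕ} (x ϑ : Fin d → ℝ) : ℝ :=
  ∑ j, ((x j * ϑ j - taylorWithinEval E.F 2 Set.univ 0 (ϑ j)) / E.φ + E.K (x j) E.φ)

end EDF

section Model

variable (E : EDF) (β : ℝ) {d κ N : ℕ} (x : Fin N → Fin d → ℝ)

/-- The `β`-VAE objective with decoder `ϑ(z) = W z + b`, prior `𝒩(0, I)` and variational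
distributions `𝒩(μ i, Sig i)`:
`(1/N) ∑ᵢ (𝔼_{Z ∼ 𝒩(μ i, Sig i)} [log P_{ϑ(Z)}(x i)] - β D_KL(𝒩(μ i, Sig i) ‖ 𝒩(0, I)))`,
where the log-likelihood is replaced by its second order Taylor polynomial. -/
def jointObjective (W : Matrix (Fin d) (Fin κ) ℝ) (b : Fin d → ℝ)
    (μ : Fin N → EuclideanSpace ℝ (Fin κ)) (Sig : Fin N → Matrix (Fin κ) (Fin κ) ℝ) : ℝ :=
  (N : ℝ)⁻¹ * ∑ i,
    ((∫ z, E.logLikTaylor (x i) (W *ᵥ z.ofLp + b) ∂(multivariateGaussian (μ i) (Sig i)))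
      - β * (klDiv (multivariateGaussian (μ i) (Sig i))
          (stdGaussian (EuclideanSpace ℝ (Fin κ)))).toReal)

/-- The admissible variational parameters: all covariance matrices are positive definite. -/
def varParams (N κ : ℕ) :
    Set ((Fin N → EuclideanSpace ℝ (Fin κ)) × (Fin N → Matrix (Fin κ) (Fin κ) ℝ)) :=
  {p | ∀ i, (p.2 i).PosDef}

/-- The transformed observation `F''(0)⁻¹ (x⁽ⁱ⁾ - F'(0))`. -/
def obs (i : Fin N) : Fin d → ℝ := fun j => E.F2⁻¹ * (x i j - E.F1)

/-- `C = F''(0)⁻¹ φ I + β⁻¹ W Wᵀ`. -/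
def matC (W : Matrix (Fin d) (Fin κ) ℝ) : Matrix (Fin d) (Fin d) ℝ :=
  (E.F2⁻¹ * E.φ) • (1 : Matrix (Fin d) (Fin d) ℝ) + β⁻¹ • (W * Wᵀ)

/-- `S = (1/N) ∑ᵢ (F''(0)⁻¹ (x⁽ⁱ⁾ - F'(0)) - b) (F''(0)⁻¹ (x⁽ⁱ⁾ - F'(0)) - b)ᵀ`. -/
def matS (b : Fin d → ℝ) : Matrix (Fin d) (Fin d) ℝ :=
  (N : ℝ)⁻¹ • ∑ i, vecMulVec (obs E x i - b) (obs E x i - b)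

/-- The part `D(φ)` of the objective which does not depend on `W` and `b`. -/
def constD : ℝ :=
  2 * d / E.φ * E.F0
    - (N : ℝ)⁻¹ * ∑ i, (1 / (E.F2 * E.φ) * ∑ j, (x i j - E.F1) ^ 2 + 2 * ∑ j, E.K (x i j) E.φ)

/-- The approximate objective
`-1/2 (tr(C⁻¹ S) + β log |C| + β d log(φ⁻¹ F''(0)) + D(φ))` as a function of `W` and `b`. -/
def approxObjective (W : Matrix (Fin d) (Fin κ) ℝ) (b : Fin d → ℝ) : ℝ :=
  -(1 / 2) * (((matC E β W)⁻¹ * matS E x b).trace + β * Real.log (matC E β W).det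
    + β * d * Real.log (E.φ⁻¹ * E.F2) + constD E x)

/-- The sample mean of the transformed observations. -/
def bHat : Fin d → ℝ := (N : ℝ)⁻¹ • ∑ i, obs E x i

/-- The sample mean of the observations. -/
def xBar : Fin d → ℝ := (N : ℝ)⁻¹ • ∑ i, x i

/-- The sample covariance of the transformed observations. -/
def sampleCov : Matrix (Fin d) (Fin d) ℝ := matS E x (bHat E x)

theorem isHermitian_sampleCov : (sampleCov E x).IsHermitian := by
  simp only [sampleCov, matS, Matrix.IsHermitian, conjTranspose_eq_transpose_of_trivial,
    transpose_smul, transpose_sum, transpose_vecMulVec]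

/-- The eigenvalues `λ₁ ≥ … ≥ λ_d` of the sample covariance, with multiplicity. -/
def eig (j : Fin d) : ℝ :=
  (isHermitian_sampleCov E x).eigenvalues₀ (Fin.cast (Fintype.card_fin d).symm j)

/-- The cut-off `β F''(0)⁻¹ φ`. -/
def cutOff : ℝ := β * E.F2⁻¹ * E.φ

/-- The columns of `U` are orthonormal eigenvectors of the sample covariance, the `j`-th one for
the `j`-th largest eigenvalue. -/
def IsTopEigenvectors (hκ : κ ≤ d) (U : Matrix (Fin d) (Fin κ) ℝ) : Prop :=
  Uᵀ * U = 1 ∧ ∀ j, sampleCov E x *ᵥ U.col j = eig E x (Fin.castLE hκ j) • U.col j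

open Classical in
/-- `k_j = λ_j` if `λ_j` is at least the cut-off, and `k_j` is the cut-off otherwise. -/
def kEntry (hκ : κ ≤ d) (j : Fin κ) : ℝ :=
  if cutOff E β ≤ eig E x (Fin.castLE hκ j) then eig E x (Fin.castLE hκ j) else cutOff E β

/-- `K_κ`. -/
def matK (hκ : κ ≤ d) : Matrix (Fin κ) (Fin κ) ℝ := diagonal (kEntry E β x hκ)

/-- `L = (K_κ - β F''(0)⁻¹ φ I)^{1/2}`. -/
def matL (hκ : κ ≤ d) : Matrix (Fin κ) (Fin κ) ℝ :=
  diagonal fun j => Real.sqrt (kEntry E β x hκ j - cutOff E β)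

/-- `Ŵ = U_κ L R`. -/
def wHat (hκ : κ ≤ d) (U : Matrix (Fin d) (Fin κ) ℝ) (R : Matrix (Fin κ) (Fin κ) ℝ) :
    Matrix (Fin d) (Fin κ) ℝ :=
  U * matL E β x hκ * R

/-- `Σ̂_z = (β φ / F''(0)) Rᵀ K_κ⁻¹ R`. -/
def sigmaHat (hκ : κ ≤ d) (R : Matrix (Fin κ) (Fin κ) ℝ) : Matrix (Fin κ) (Fin κ) ℝ :=
  (β * E.φ / E.F2) • (Rᵀ * (matK E β x hκ)⁻¹ * R)

/-- `μ̂_z⁽ⁱ⁾ = Rᵀ K_κ⁻¹ L U_κᵀ F''(0)⁻¹ (x⁽ⁱ⁾ - x̄)`. -/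
def muHat (hκ : κ ≤ d) (U : Matrix (Fin d) (Fin κ) ℝ) (R : Matrix (Fin κ) (Fin κ) ℝ) (i : Fin N) :
    EuclideanSpace ℝ (Fin κ) :=
  WithLp.toLp 2
    ((Rᵀ * (matK E β x hκ)⁻¹ * matL E β x hκ * Uᵀ) *ᵥ ((1 / E.F2) • (x i - xBar x)))

end Model

end BetaVAE

end

open BetaVAE

/-! The Taylor polynomial is quadratic in the decoder output, so everything is a Gaussian
computation. With c the cut-off and r the `i`-th transformed observation minus `b`, the `i`-th
summand of the joint objective is, up to terms free of the variational parameters, -β/2 times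
c⁻¹(‖Wμ - r‖² + tr(WᵀWΣ)) + ‖μ‖² + tr Σ - log|Σ|. Completing the square in μ and comparing tr(MΣ) -
log|Σ| with its minimum at Σ = M⁻¹, where M = c⁻¹(cI + WᵀW), splits off a nonnegative `gap` that
vanishes at exactly one pair (μ, Σ). The Woodbury and Sylvester identities turn what remains into
the approximate objective (`jointObjective_eq`). This settles the variational parameters for every
`W` and `b`.

The mean shift enters the approximate objective through a positive definite quadratic form, which
forces `b = bHat`. What is left is `ppcaLoss`: probabilistic PCA with fixed noise level c.
Diagonalize the sample covariance by V, with eigenvalues λ, and WWᵀ by U, with eigenvalues l. The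
loss is then the average of the scalar costs log(c + l_j) + λ_i/(c + l_j) with weights (VᵀU)_ij²,
which form a doubly stochastic matrix (`ppcaLoss_eq`). Birkhoff's theorem and the rearrangement
inequality allow the eigenvalues to be paired in order, and each scalar cost is minimal at c + l_j =
max(λ_j, c); the rank bound leaves only κ free values l_j. This gives the lower bound `ppcaMin`,
attained at `wHat` (`ppcaLoss_eq_ppcaMin`).

For the converse, the minimization over doubly stochastic weights is treated as a linear program.
Explicit dual potentials and complementary slackness (`max_eq_of_ppcaLoss_le`) show that U only
mixes eigenvectors of S with the same truncated eigenvalue. Hence WWᵀ is the expected matrix even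
when eigenvalues coincide, and W is recovered from WWᵀ up to an orthogonal factor, whose determinant
is made 1 by flipping the sign of one eigenvector. The remaining claims are read off from WᵀW =
RᵀL²R. -/

noncomputable section

namespace BetaVAE

/-! ### Densities of standard Gaussians and of their affine images -/

section Gaussian

variable {n : ℕ}

/-- The Lebesgue density of the standard Gaussian distribution on `ℝⁿ`. -/
def stdGaussianPDF (n : ℕ) (x : EuclideanSpace ℝ (Fin n)) : ℝ :=
  ((2 * Real.pi) ^ (n / 2 : ℝ))⁻¹ * Real.exp (-(1 / 2) * ‖x‖ ^ 2)

theorem stdGaussianPDF_pos (x : EuclideanSpace ℝ (Fin n)) : 0 < stdGaussianPDF n x := by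
  unfold stdGaussianPDF; positivity

theorem continuous_stdGaussianPDF : Continuous (stdGaussianPDF n) := by
  unfold stdGaussianPDF; fun_prop

theorem measurable_ofReal_stdGaussianPDF :
    Measurable fun x => ENNReal.ofReal (stdGaussianPDF n x) :=
  continuous_stdGaussianPDF.measurable.ennreal_ofReal

theorem integrable_stdGaussianPDF : Integrable (stdGaussianPDF n) volume := by
  have h := (GaussianFourier.integrable_cexp_neg_mul_sq_norm_add (V := EuclideanSpace ℝ (Fin n))
    (b := (1 / 2 : ℂ)) (by norm_num) 0 0).norm
  refine (h.const_mul ((2 * Real.pi) ^ (n / 2 : ℝ))⁻¹).congr (ae_of_all _ fun x => ?_)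
  simp [stdGaussianPDF, Complex.norm_exp, ← Complex.ofReal_pow]

/-- Both sides are finite measures with the same characteristic function, by the Gaussian Fourier
integral. -/
theorem stdGaussian_eq_withDensity :
    stdGaussian (EuclideanSpace ℝ (Fin n))
      = volume.withDensity fun x => ENNReal.ofReal (stdGaussianPDF n x) := by
  have : IsFiniteMeasure ((volume : Measure (EuclideanSpace ℝ (Fin n))).withDensity
      fun x => ENNReal.ofReal (stdGaussianPDF n x)) :=
    isFiniteMeasure_withDensity_ofReal integrable_stdGaussianPDF.2
  refine Measure.ext_of_charFun (funext fun t => ?_)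
  rw [charFun_stdGaussian, charFun_apply,
    integral_withDensity_eq_integral_toReal_smul measurable_ofReal_stdGaussianPDF
      (ae_of_all _ fun _ => ENNReal.ofReal_lt_top)]
  have h := GaussianFourier.integral_cexp_neg_mul_sq_norm_add (V := EuclideanSpace ℝ (Fin n))
    (b := (1 / 2 : ℂ)) (by norm_num) Complex.I t
  have h2 : ∀ x : EuclideanSpace ℝ (Fin n),
      (ENNReal.ofReal (stdGaussianPDF n x)).toReal • Complex.exp (inner ℝ x t * Complex.I)
      = ((((2 * Real.pi) ^ (n / 2 : ℝ))⁻¹ : ℝ) : ℂ) *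
        Complex.exp (-(1 / 2 : ℂ) * ‖x‖ ^ 2 + Complex.I * inner ℝ t x) := by
    intro x
    rw [ENNReal.toReal_ofReal (stdGaussianPDF_pos x).le, Complex.real_smul, stdGaussianPDF,
      Complex.exp_add, real_inner_comm]
    push_cast
    rw [mul_comm Complex.I]
    ring
  simp_rw [h2]
  rw [integral_const_mul, h]
  have h3 : (Real.pi / (1 / 2 : ℂ)) ^ (Module.finrank ℝ (EuclideanSpace ℝ (Fin n)) / 2 : ℂ)
      = (((2 * Real.pi) ^ (n / 2 : ℝ) : ℝ) : ℂ) := by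
    rw [Complex.ofReal_cpow (by positivity)]
    simp
    ring_nf
  rw [h3, ← mul_assoc, ← Complex.ofReal_mul, inv_mul_cancel₀ (by positivity)]
  simp
  ring_nf

/-- The density of the image of the standard Gaussian distribution under the map
`x ↦ μ + A x` with respect to the standard Gaussian distribution, where `B` inverts `A`. -/
theorem map_affine_stdGaussian_eq_withDensity (μ : EuclideanSpace ℝ (Fin n))
    (A B : EuclideanSpace ℝ (Fin n) →L[ℝ] EuclideanSpace ℝ (Fin n))
    (hBA : ∀ x, B (A x) = x) (hdet : LinearMap.det (A : EuclideanSpace ℝ (Fin n) →ₗ[ℝ] _) ≠ 0) :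
    (stdGaussian (EuclideanSpace ℝ (Fin n))).map (fun x => μ + A x)
      = (stdGaussian (EuclideanSpace ℝ (Fin n))).withDensity fun y =>
        ENNReal.ofReal (|(LinearMap.det (A : EuclideanSpace ℝ (Fin n) →ₗ[ℝ] _))⁻¹| *
          Real.exp (1 / 2 * ‖y‖ ^ 2 - 1 / 2 * ‖B (y - μ)‖ ^ 2)) := by
  set D := |(LinearMap.det (A : EuclideanSpace ℝ (Fin n) →ₗ[ℝ] _))⁻¹|
  have hD : 0 ≤ D := abs_nonneg _
  refine Measure.ext_of_lintegral _ fun f hf => ?_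
  have hm : Measurable fun y : EuclideanSpace ℝ (Fin n) => ENNReal.ofReal
      (D * Real.exp (1 / 2 * ‖y‖ ^ 2 - 1 / 2 * ‖B (y - μ)‖ ^ 2)) := by fun_prop
  rw [lintegral_map hf (by fun_prop), lintegral_withDensity_eq_lintegral_mul _ hm hf,
    stdGaussian_eq_withDensity,
    lintegral_withDensity_eq_lintegral_mul _ measurable_ofReal_stdGaussianPDF
      (by fun_prop),
    lintegral_withDensity_eq_lintegral_mul _ measurable_ofReal_stdGaussianPDF
      (hm.mul hf)]
  have hmap := Measure.map_linearMap_addHaar_eq_smul_addHaar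
    (volume : Measure (EuclideanSpace ℝ (Fin n))) hdet
  have hh : Measurable fun y : EuclideanSpace ℝ (Fin n) =>
      ENNReal.ofReal (stdGaussianPDF n (B y)) * f (μ + y) :=
    (continuous_stdGaussianPDF.comp B.continuous).measurable.ennreal_ofReal.mul (by fun_prop)
  -- Change of variables: first the linear map `A`, which contributes the determinant factor, then
  -- the translation by `μ`.
  calc ∫⁻ a, ((fun x => ENNReal.ofReal (stdGaussianPDF n x)) * fun x => f (μ + A x)) a
      = ∫⁻ a, (fun y => ENNReal.ofReal (stdGaussianPDF n (B y)) * f (μ + y)) (A a) := by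
        simp [hBA]
    _ = ∫⁻ y, ENNReal.ofReal (stdGaussianPDF n (B y)) * f (μ + y) ∂(volume.map A) :=
        (lintegral_map hh A.measurable).symm
    _ = ENNReal.ofReal D * ∫⁻ y, ENNReal.ofReal (stdGaussianPDF n (B y)) * f (μ + y) := by
        have : (volume.map A) = ENNReal.ofReal D • (volume : Measure (EuclideanSpace ℝ (Fin n))) :=
          hmap
        rw [this, lintegral_smul_measure, smul_eq_mul]
    _ = ENNReal.ofReal D * ∫⁻ y, ENNReal.ofReal (stdGaussianPDF n (B (y - μ))) * f y := by
        congr 1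
        rw [← lintegral_add_left_eq_self
          (fun y => ENNReal.ofReal (stdGaussianPDF n (B (y - μ))) * f y) μ]
        simp
    _ = _ := by
        rw [← lintegral_const_mul]
        · refine lintegral_congr fun y => ?_
          simp only [Pi.mul_apply]
          rw [← mul_assoc, ← mul_assoc, ← ENNReal.ofReal_mul hD,
            ← ENNReal.ofReal_mul (stdGaussianPDF_pos y).le]
          congr 2
          have h1 : Real.exp (-(1 / 2) * ‖B (y - μ)‖ ^ 2) = Real.exp (-(1 / 2) * ‖y‖ ^ 2) *
              Real.exp (1 / 2 * ‖y‖ ^ 2 - 1 / 2 * ‖B (y - μ)‖ ^ 2) := by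
            rw [← Real.exp_add]; ring_nf
          rw [stdGaussianPDF, stdGaussianPDF, h1]
          ring
        · refine Measurable.mul ?_ hf
          exact (continuous_stdGaussianPDF.comp (B.continuous.comp
            (continuous_id.sub continuous_const))).measurable.ennreal_ofReal

end Gaussian

/-! ### First and second moments of Gaussians and the Kullback-Leibler divergence -/

section GaussianMoments

variable {n : ℕ} {μ : EuclideanSpace ℝ (Fin n)} {S : Matrix (Fin n) (Fin n) ℝ}

theorem memLp_dotProduct_multivariateGaussian (w : Fin n → ℝ) :
    MemLp (fun z : EuclideanSpace ℝ (Fin n) => w ⬝ᵥ z.ofLp) 2 (multivariateGaussian μ S) := by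
  have h : MemLp (id : EuclideanSpace ℝ (Fin n) → _) 2 (multivariateGaussian μ S) :=
    IsGaussian.memLp_two_id
  have h2 := (innerSL ℝ (WithLp.toLp 2 w)).comp_memLp' h
  refine h2.congr_norm (by fun_prop) (ae_of_all _ fun z => ?_)
  simp [EuclideanSpace.inner_eq_star_dotProduct, dotProduct_comm]

theorem integral_dotProduct_multivariateGaussian (w : Fin n → ℝ) :
    ∫ z, w ⬝ᵥ z.ofLp ∂(multivariateGaussian μ S) = w ⬝ᵥ μ.ofLp := by
  have h := (innerSL ℝ (WithLp.toLp 2 w)).integral_comp_comm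
    (IsGaussian.integrable_id (μ := multivariateGaussian μ S))
  simpa [EuclideanSpace.inner_eq_star_dotProduct, dotProduct_comm] using h

/-- The second moment of a linear functional is its squared mean plus its variance, and the variance
is the covariance form at `w`. -/
theorem integral_sq_dotProduct_multivariateGaussian (hS : S.PosSemidef) (w : Fin n → ℝ) :
    ∫ z, (w ⬝ᵥ z.ofLp) ^ 2 ∂(multivariateGaussian μ S) = (w ⬝ᵥ μ.ofLp) ^ 2 + w ⬝ᵥ S *ᵥ w := by
  have h := covarianceBilin_multivariateGaussian (μ := μ) hS (WithLp.toLp 2 w) (WithLp.toLp 2 w)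
  rw [covarianceBilin_apply_eq_cov IsGaussian.memLp_two_id] at h
  have h1 : (fun u : EuclideanSpace ℝ (Fin n) => inner ℝ (WithLp.toLp 2 w) u)
      = fun z => w ⬝ᵥ z.ofLp := by
    ext z; simp [EuclideanSpace.inner_eq_star_dotProduct, dotProduct_comm]
  rw [h1, covariance_eq_sub (memLp_dotProduct_multivariateGaussian w)
    (memLp_dotProduct_multivariateGaussian w), integral_dotProduct_multivariateGaussian] at h
  simp only [Pi.mul_apply, ← pow_two] at h
  linarith

theorem integrable_dotProduct_multivariateGaussian (w : Fin n → ℝ) :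
    Integrable (fun z : EuclideanSpace ℝ (Fin n) => w ⬝ᵥ z.ofLp) (multivariateGaussian μ S) :=
  (memLp_dotProduct_multivariateGaussian w).integrable (by norm_num)

theorem integrable_sq_dotProduct_multivariateGaussian (w : Fin n → ℝ) :
    Integrable (fun z : EuclideanSpace ℝ (Fin n) => (w ⬝ᵥ z.ofLp) ^ 2)
      (multivariateGaussian μ S) :=
  (memLp_dotProduct_multivariateGaussian w).integrable_sq

theorem integrable_norm_sq_multivariateGaussian :
    Integrable (fun z : EuclideanSpace ℝ (Fin n) => ‖z‖ ^ 2) (multivariateGaussian μ S) :=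
  (IsGaussian.memLp_two_id (μ := multivariateGaussian μ S)).norm.integrable_sq

theorem integral_norm_sq_multivariateGaussian (hS : S.PosSemidef) :
    ∫ z, ‖z‖ ^ 2 ∂(multivariateGaussian μ S) = μ.ofLp ⬝ᵥ μ.ofLp + S.trace := by
  have h : ∀ z : EuclideanSpace ℝ (Fin n),
      ‖z‖ ^ 2 = ∑ i, (Pi.single i (1 : ℝ) ⬝ᵥ z.ofLp) ^ 2 := by
    intro z
    simp [EuclideanSpace.real_norm_sq_eq]
  simp_rw [h]
  rw [integral_finsetSum _ fun i _ => integrable_sq_dotProduct_multivariateGaussian _]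
  simp_rw [integral_sq_dotProduct_multivariateGaussian hS]
  simp only [single_dotProduct, mulVec_single_one, one_mul, Finset.sum_add_distrib, trace, pow_two]
  rfl

open scoped MatrixOrder in
/-- The Kullback-Leibler divergence of a nondegenerate Gaussian distribution from the standard
Gaussian distribution. -/
theorem toReal_klDiv_multivariateGaussian_stdGaussian (hS : S.PosDef) :
    (klDiv (multivariateGaussian μ S) (stdGaussian (EuclideanSpace ℝ (Fin n)))).toReal
      = 1 / 2 * (S.trace + μ.ofLp ⬝ᵥ μ.ofLp - n - Real.log S.det) := by
  have hQQ : CFC.sqrt S * CFC.sqrt S = S := by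
    exact CFC.sqrt_mul_sqrt_self _ hS.posSemidef.nonneg
  set Q := CFC.sqrt S with hQ
  have hdetS : 0 < S.det := hS.det_pos
  have hdet2 : Q.det * Q.det = S.det := by rw [← det_mul, hQQ]
  have hQ0 : Q.det ≠ 0 := fun h => by rw [h] at hdet2; linarith [hdet2]
  set A := toEuclideanCLM (𝕜 := ℝ) Q with hA
  set B := toEuclideanCLM (𝕜 := ℝ) Q⁻¹ with hB
  have hBA : ∀ x, B (A x) = x := by
    intro x
    rw [← mul_apply_eq_comp, hA, hB, ← map_mul,
      nonsing_inv_mul _ (isUnit_iff_ne_zero.2 hQ0)]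
    simp
  have hdetA : LinearMap.det (A : EuclideanSpace ℝ (Fin n) →ₗ[ℝ] _) = Q.det :=
    LinearMap.det_toLpLin 2 Q
  have hdef : multivariateGaussian μ S
      = (stdGaussian (EuclideanSpace ℝ (Fin n))).map fun x => μ + A x := rfl
  have hwd := map_affine_stdGaussian_eq_withDensity μ A B hBA (by rwa [hdetA])
  rw [hdetA, ← hdef] at hwd
  set g : EuclideanSpace ℝ (Fin n) → ℝ := fun y =>
    |Q.det⁻¹| * Real.exp (1 / 2 * ‖y‖ ^ 2 - 1 / 2 * ‖B (y - μ)‖ ^ 2) with hg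
  have hac : multivariateGaussian μ S ≪ stdGaussian (EuclideanSpace ℝ (Fin n)) := by
    rw [hwd]; exact withDensity_absolutelyContinuous _ _
  have hm : Measurable fun y => ENNReal.ofReal (g y) := by fun_prop
  have hrn : (multivariateGaussian μ S).rnDeriv (stdGaussian (EuclideanSpace ℝ (Fin n)))
      =ᵐ[multivariateGaussian μ S] fun y => ENNReal.ofReal (g y) := by
    refine hac.ae_eq ?_
    conv_lhs => rw [hwd]
    exact Measure.rnDeriv_withDensity _ hm
  have hllr : llr (multivariateGaussian μ S) (stdGaussian (EuclideanSpace ℝ (Fin n)))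
      =ᵐ[multivariateGaussian μ S]
        fun y => Real.log |Q.det⁻¹| + (1 / 2 * ‖y‖ ^ 2 - 1 / 2 * ‖B (y - μ)‖ ^ 2) := by
    filter_upwards [hrn] with y hy
    rw [llr, hy, ENNReal.toReal_ofReal (by positivity), hg,
      Real.log_mul (by simpa using hQ0) (Real.exp_pos _).ne', Real.log_exp]
  -- Standardizing the Gaussian gives the standard one, so the quadratic term of the log-density
  -- ratio has expectation `n`.
  have hmapB : (multivariateGaussian μ S).map (fun y => B (y - μ))
      = multivariateGaussian 0 (1 : Matrix (Fin n) (Fin n) ℝ) := by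
    rw [hdef, Measure.map_map (by fun_prop) (by fun_prop), multivariateGaussian_zero_one]
    convert Measure.map_id
    ext1 x
    simp [hBA]
  have hI : Integrable (fun y => ‖B (y - μ)‖ ^ 2) (multivariateGaussian μ S) := by
    have h := integrable_norm_sq_multivariateGaussian (n := n) (μ := 0) (S := 1)
    rw [← hmapB] at h
    exact h.comp_measurable (by fun_prop)
  have hIv : ∫ y, ‖B (y - μ)‖ ^ 2 ∂(multivariateGaussian μ S) = n := by
    rw [← integral_map (φ := fun y => B (y - μ)) (f := fun z => ‖z‖ ^ 2) (by fun_prop)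
      (by fun_prop), hmapB, integral_norm_sq_multivariateGaussian PosSemidef.one]
    simp
  have hI2 : Integrable (fun y => 1 / 2 * ‖y‖ ^ 2 - 1 / 2 * ‖B (y - μ)‖ ^ 2)
      (multivariateGaussian μ S) :=
    (integrable_norm_sq_multivariateGaussian.const_mul _).sub (hI.const_mul _)
  -- Both measures have mass 1, so the divergence is the integral of the log-likelihood ratio with
  -- no mass correction.
  rw [toReal_klDiv_of_measure_eq hac (by simp), integral_congr_ae hllr,
    integral_add (integrable_const _) hI2,
    integral_sub (integrable_norm_sq_multivariateGaussian.const_mul _) (hI.const_mul _),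
    integral_const_mul, integral_const_mul, hIv,
    integral_norm_sq_multivariateGaussian hS.posSemidef]
  have hlog : Real.log |Q.det⁻¹| = -(1 / 2) * Real.log S.det := by
    rw [Real.log_abs, Real.log_inv, ← hdet2, Real.log_mul hQ0 hQ0]; ring
  rw [hlog]
  simp
  ring

end GaussianMoments

/-! ### Log-determinant inequalities, Woodbury and Sylvester identities, completing the square -/

section LinearAlgebra

variable {m n : ℕ}

/-- The spectral theorem for real symmetric matrices, with the eigenvalues in decreasing order. -/
theorem exists_orthogonal_diagonalization {A : Matrix (Fin n) (Fin n) ℝ} (hA : A.IsHermitian) :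
    ∃ V : Matrix (Fin n) (Fin n) ℝ, Vᵀ * V = 1 ∧ V * Vᵀ = 1 ∧
      A = V * diagonal (fun j => hA.eigenvalues₀ (Fin.cast (Fintype.card_fin n).symm j)) * Vᵀ := by
  -- `eigenvalues` is `eigenvalues₀` reindexed by an unspecified equivalence; `e` undoes it, so that
  -- permuting the eigenvectors by `e` sorts them.
  let e : Fin n ≃ Fin n := (finCongr (Fintype.card_fin n).symm).trans
    (Fintype.equivOfCardEq (Fintype.card_fin _))
  have he : (fun j => hA.eigenvalues₀ (Fin.cast (Fintype.card_fin n).symm j))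
      = hA.eigenvalues ∘ e := by
    ext j; simp [IsHermitian.eigenvalues, e]
  let V₀ : Matrix (Fin n) (Fin n) ℝ := hA.eigenvectorUnitary
  have h1 : V₀ᵀ * V₀ = 1 := Unitary.coe_star_mul_self hA.eigenvectorUnitary
  have h2 : V₀ * V₀ᵀ = 1 := Unitary.coe_mul_star_self hA.eigenvectorUnitary
  have h3 : A = V₀ * diagonal hA.eigenvalues * V₀ᵀ := hA.spectral_theorem
  have hV : (V₀.submatrix id e)ᵀ * V₀.submatrix id e = 1 := by
    rw [transpose_submatrix, ← submatrix_mul _ _ e id e Function.bijective_id, h1,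
      submatrix_one_equiv]
  refine ⟨V₀.submatrix id e, hV, mul_eq_one_comm.1 hV, ?_⟩
  rw [he, ← submatrix_diagonal_equiv, submatrix_mul_equiv, transpose_submatrix,
    submatrix_mul_equiv, ← h3, submatrix_id_id]

theorem antitone_eigenvalues₀_cast {A : Matrix (Fin n) (Fin n) ℝ} (hA : A.IsHermitian) :
    Antitone fun j => hA.eigenvalues₀ (Fin.cast (Fintype.card_fin n).symm j) :=
  fun _ _ h => hA.eigenvalues₀_antitone (by simpa using h)

/-- Sum log t ≤ t - 1 over the eigenvalues. -/
theorem log_det_le_trace_sub {A : Matrix (Fin n) (Fin n) ℝ} (hA : A.PosDef) :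
    Real.log A.det ≤ A.trace - n := by
  have h1 : A.det = ∏ i, hA.1.eigenvalues i := by simpa using hA.1.det_eq_prod_eigenvalues
  have h2 : A.trace = ∑ i, hA.1.eigenvalues i := by simpa using hA.1.trace_eq_sum_eigenvalues
  rw [h1, h2, Real.log_prod fun i _ => (hA.eigenvalues_pos i).ne']
  calc _ ≤ ∑ i, (hA.1.eigenvalues i - 1) :=
        Finset.sum_le_sum fun i _ => Real.log_le_sub_one_of_pos (hA.eigenvalues_pos i)
    _ = _ := by simp

/-- Since log t < t - 1 for t ≠ 1, equality forces every eigenvalue to be 1. -/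
theorem eq_one_of_log_det_eq_trace_sub {A : Matrix (Fin n) (Fin n) ℝ} (hA : A.PosDef)
    (h : Real.log A.det = A.trace - n) : A = 1 := by
  have h1 : A.det = ∏ i, hA.1.eigenvalues i := by simpa using hA.1.det_eq_prod_eigenvalues
  have h2 : A.trace = ∑ i, hA.1.eigenvalues i := by simpa using hA.1.trace_eq_sum_eigenvalues
  rw [h1, h2, Real.log_prod fun i _ => (hA.eigenvalues_pos i).ne'] at h
  have h3 : ∑ i, Real.log (hA.1.eigenvalues i) = ∑ i, (hA.1.eigenvalues i - 1) := by
    rw [h]; simp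
  have h4 := (Finset.sum_eq_sum_iff_of_le fun i _ =>
    Real.log_le_sub_one_of_pos (hA.eigenvalues_pos i)).1 h3
  have h5 : hA.1.eigenvalues = fun _ => 1 := by
    ext i
    by_contra hne
    exact (Real.log_lt_sub_one_of_pos (hA.eigenvalues_pos i) hne).ne (h4 i (Finset.mem_univ i))
  have h6 := hA.1.spectral_theorem
  rw [h5] at h6
  rw [h6]
  have : (diagonal (RCLike.ofReal ∘ fun _ : Fin n => (1 : ℝ)) : Matrix (Fin n) (Fin n) ℝ) = 1 := by
    ext i j; simp [diagonal, one_apply]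
  rw [this, map_one]

open scoped MatrixOrder in
theorem posDef_exists_eq_transpose_mul_self {M : Matrix (Fin n) (Fin n) ℝ} (hM : M.PosDef) :
    ∃ B : Matrix (Fin n) (Fin n) ℝ, IsUnit B.det ∧ M = Bᵀ * B := by
  obtain ⟨B, hB⟩ := CStarAlgebra.nonneg_iff_eq_star_mul_self.mp hM.posSemidef.nonneg
  have hB' : M = Bᵀ * B := hB
  refine ⟨B, isUnit_iff_ne_zero.2 fun h => hM.det_pos.ne' ?_, hB'⟩
  rw [hB', det_mul, h, mul_zero]

theorem posDef_mul_mul_transpose_same {S B : Matrix (Fin n) (Fin n) ℝ} (hS : S.PosDef)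
    (hB : IsUnit B.det) : (B * S * Bᵀ).PosDef := by
  have h : Function.Injective (Bᵀ).mulVec :=
    mulVec_injective_of_isUnit ((isUnit_iff_isUnit_det _).2 (by rwa [det_transpose]))
  simpa using hS.conjTranspose_mul_mul_same h

/-- The function `S ↦ tr (M S) - log |S|` on positive definite matrices is at least
`n + log |M|`. -/
theorem trace_mul_sub_log_det_nonneg {M S : Matrix (Fin n) (Fin n) ℝ} (hM : M.PosDef)
    (hS : S.PosDef) : 0 ≤ (M * S).trace - n - Real.log M.det - Real.log S.det := by
  obtain ⟨B, hB, rfl⟩ := posDef_exists_eq_transpose_mul_self hM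
  -- For `M = BᵀB`, the matrix `B S Bᵀ` is symmetric with the trace and the determinant of `M S`.
  have h := log_det_le_trace_sub (posDef_mul_mul_transpose_same hS hB)
  rw [trace_mul_comm, ← mul_assoc, det_mul, det_mul, mul_right_comm, mul_comm B.det,
    ← det_mul,
    Real.log_mul hM.det_pos.ne' hS.det_pos.ne'] at h
  linarith

/-- The minimum in `trace_mul_sub_log_det_nonneg` is attained only at `M⁻¹`. -/
theorem trace_mul_sub_log_det_eq_zero_iff {M S : Matrix (Fin n) (Fin n) ℝ} (hM : M.PosDef)
    (hS : S.PosDef) :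
    (M * S).trace - n - Real.log M.det - Real.log S.det = 0 ↔ S = M⁻¹ := by
  constructor
  · intro h
    obtain ⟨B, hB, rfl⟩ := posDef_exists_eq_transpose_mul_self hM
    have h1 : B * S * Bᵀ = 1 := by
      refine eq_one_of_log_det_eq_trace_sub (posDef_mul_mul_transpose_same hS hB) ?_
      rw [trace_mul_comm, ← mul_assoc, det_mul, det_mul, mul_right_comm, mul_comm B.det,
    ← det_mul,
        Real.log_mul hM.det_pos.ne' hS.det_pos.ne']
      linarith
    have h2 : S * Bᵀ * B = 1 := by
      rw [mul_eq_one_comm, ← mul_assoc, h1]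
    exact (inv_eq_left_inv (by rwa [← mul_assoc])).symm
  · rintro rfl
    have hu : IsUnit M.det := isUnit_iff_ne_zero.2 hM.det_pos.ne'
    rw [mul_nonsing_inv _ hu, det_nonsing_inv, Ring.inverse_eq_inv', Real.log_inv]
    simp

variable (W : Matrix (Fin m) (Fin n) ℝ) {c : ℝ}

theorem posDef_smul_one_add_transpose_mul_self (hc : 0 < c) :
    (c • (1 : Matrix (Fin n) (Fin n) ℝ) + Wᵀ * W).PosDef := by
  have h := posSemidef_conjTranspose_mul_self W
  rw [conjTranspose_eq_transpose_of_trivial] at h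
  exact (PosDef.one.smul hc).add_posSemidef h

theorem posDef_smul_one_add_mul_transpose_self (hc : 0 < c) :
    (c • (1 : Matrix (Fin m) (Fin m) ℝ) + W * Wᵀ).PosDef := by
  simpa using posDef_smul_one_add_transpose_mul_self Wᵀ hc

/-- Woodbury identity, from the push-through relation (cI + WWᵀ)W = W(cI + WᵀW). It reduces inverses
of size `m` to size `n`. -/
theorem inv_smul_one_add_mul_transpose_self (hc : 0 < c) :
    (c • (1 : Matrix (Fin m) (Fin m) ℝ) + W * Wᵀ)⁻¹
      = c⁻¹ • (1 - W * (c • (1 : Matrix (Fin n) (Fin n) ℝ) + Wᵀ * W)⁻¹ * Wᵀ) := by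
  set A := c • (1 : Matrix (Fin n) (Fin n) ℝ) + Wᵀ * W with hA
  have hu : IsUnit A.det :=
    isUnit_iff_ne_zero.2 (posDef_smul_one_add_transpose_mul_self W hc).det_pos.ne'
  refine inv_eq_right_inv ?_
  have h1 : (c • (1 : Matrix (Fin m) (Fin m) ℝ) + W * Wᵀ) * W = W * A := by
    simp [hA, Matrix.add_mul, Matrix.mul_add, Matrix.mul_assoc]
  rw [Matrix.mul_smul, Matrix.mul_sub, Matrix.mul_one, ← Matrix.mul_assoc, ← Matrix.mul_assoc, h1,
    Matrix.mul_assoc W, mul_nonsing_inv _ hu, Matrix.mul_one, add_sub_cancel_right, smul_smul,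
    inv_mul_cancel₀ hc.ne', one_smul]

/-- Sylvester's identity |I + XY| = |I + YX|, after pulling out the scalar c. -/
theorem det_smul_one_add_mul_transpose_self (hc : 0 < c) :
    (c • (1 : Matrix (Fin m) (Fin m) ℝ) + W * Wᵀ).det
      = c ^ m * (c⁻¹ • (c • (1 : Matrix (Fin n) (Fin n) ℝ) + Wᵀ * W)).det := by
  have h1 : c • (1 : Matrix (Fin m) (Fin m) ℝ) + W * Wᵀ = c • (1 + (c⁻¹ • W) * Wᵀ) := by
    rw [smul_add, Matrix.smul_mul, smul_smul, mul_inv_cancel₀ hc.ne', one_smul]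
  have h2 : c⁻¹ • (c • (1 : Matrix (Fin n) (Fin n) ℝ) + Wᵀ * W) = 1 + Wᵀ * (c⁻¹ • W) := by
    rw [smul_add, smul_smul, inv_mul_cancel₀ hc.ne', one_smul, Matrix.mul_smul]
  rw [h1, det_smul, Fintype.card_fin, det_one_add_mul_comm, h2]

/-- Completing the square in the regularized least squares problem. -/
theorem sq_norm_sub_add_smul_sq_norm (hc : 0 < c) (r : Fin m → ℝ) (v : Fin n → ℝ) :
    (W *ᵥ v - r) ⬝ᵥ (W *ᵥ v - r) + c * (v ⬝ᵥ v)
      = (v - (c • (1 : Matrix (Fin n) (Fin n) ℝ) + Wᵀ * W)⁻¹ *ᵥ (Wᵀ *ᵥ r)) ⬝ᵥ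
          (c • (1 : Matrix (Fin n) (Fin n) ℝ) + Wᵀ * W) *ᵥ
            (v - (c • (1 : Matrix (Fin n) (Fin n) ℝ) + Wᵀ * W)⁻¹ *ᵥ (Wᵀ *ᵥ r))
        + c * (r ⬝ᵥ (c • (1 : Matrix (Fin m) (Fin m) ℝ) + W * Wᵀ)⁻¹ *ᵥ r) := by
  rw [inv_smul_one_add_mul_transpose_self W hc]
  set A := c • (1 : Matrix (Fin n) (Fin n) ℝ) + Wᵀ * W with hA
  have hu : IsUnit A.det :=
    isUnit_iff_ne_zero.2 (posDef_smul_one_add_transpose_mul_self W hc).det_pos.ne'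
  set w := A⁻¹ *ᵥ (Wᵀ *ᵥ r) with hw
  have hAw : A *ᵥ w = Wᵀ *ᵥ r := by
    rw [hw, mulVec_mulVec, mul_nonsing_inv _ hu, one_mulVec]
  have hAv : v ⬝ᵥ A *ᵥ v = c * (v ⬝ᵥ v) + (W *ᵥ v) ⬝ᵥ (W *ᵥ v) := by
    rw [hA, add_mulVec, dotProduct_add, smul_mulVec, one_mulVec, dotProduct_smul, smul_eq_mul,
      ← mulVec_mulVec, dotProduct_mulVec v Wᵀ, vecMul_transpose]
  have hAT : Aᵀ = A := by simp [hA, transpose_mul]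
  have hwv : w ⬝ᵥ A *ᵥ v = v ⬝ᵥ Wᵀ *ᵥ r := by
    rw [dotProduct_mulVec, ← mulVec_transpose, hAT, hAw, dotProduct_comm]
  have hvr : v ⬝ᵥ Wᵀ *ᵥ r = (W *ᵥ v) ⬝ᵥ r := by
    rw [dotProduct_mulVec, vecMul_transpose]
  have hr : c * (r ⬝ᵥ (c⁻¹ • (1 - W * A⁻¹ * Wᵀ)) *ᵥ r) = r ⬝ᵥ r - w ⬝ᵥ Wᵀ *ᵥ r := by
    rw [smul_mulVec, dotProduct_smul, smul_eq_mul, ← mul_assoc, mul_inv_cancel₀ hc.ne', one_mul,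
      sub_mulVec, one_mulVec, dotProduct_sub, ← mulVec_mulVec, ← mulVec_mulVec, ← hw,
      dotProduct_mulVec w, vecMul_transpose, dotProduct_comm r (W *ᵥ w)]
  rw [hr]
  simp only [mulVec_sub, dotProduct_sub, sub_dotProduct, hAv, hAw, hwv, hvr,
    dotProduct_comm r (W *ᵥ v)]
  ring

end LinearAlgebra

/-! ### Optimizing the variational parameters -/

section JointObjective

theorem _root_.Matrix.PosDef.quadraticForm_nonneg {n : ℕ} {A : Matrix (Fin n) (Fin n) ℝ}
    (hA : A.PosDef) (v : Fin n → ℝ) : 0 ≤ v ⬝ᵥ A *ᵥ v := by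
  simpa using hA.posSemidef.dotProduct_mulVec_nonneg v

theorem _root_.Matrix.PosDef.quadraticForm_eq_zero_iff {n : ℕ} {A : Matrix (Fin n) (Fin n) ℝ}
    (hA : A.PosDef) {v : Fin n → ℝ} : v ⬝ᵥ A *ᵥ v = 0 ↔ v = 0 := by
  refine ⟨fun h => ?_, fun h => by simp [h]⟩
  by_contra hne
  simpa [h] using hA.dotProduct_mulVec_pos hne

variable (E : EDF) {d κ N : ℕ}

/-- Completing the square in each coordinate: the centre of the parabola is the transformed
observation. -/
theorem EDF.logLikTaylor_eq (hF2 : 0 < E.F2) (x ϑ : Fin d → ℝ) :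
    E.logLikTaylor x ϑ
      = -(E.F2 / E.φ / 2) * ∑ j, (ϑ j - E.F2⁻¹ * (x j - E.F1)) ^ 2
        + (1 / (2 * (E.F2 * E.φ)) * ∑ j, (x j - E.F1) ^ 2 - d / E.φ * E.F0 + ∑ j, E.K (x j) E.φ) := by
  have hφ := E.φ_pos.ne'
  have hT : ∀ t, taylorWithinEval E.F 2 Set.univ 0 t = E.F0 + E.F1 * t + E.F2 / 2 * t ^ 2 := by
    intro t
    rw [taylorWithinEval_succ, taylorWithinEval_succ, taylor_within_zero_eval,
      iteratedDerivWithin_univ, iteratedDerivWithin_univ, zero_add, iteratedDeriv_one]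
    simp [EDF.F0, EDF.F1, EDF.F2]
    ring
  have hd : (d : ℝ) / E.φ * E.F0 = ∑ _j : Fin d, E.F0 / E.φ := by
    simp; ring
  rw [EDF.logLikTaylor, hd, Finset.mul_sum, Finset.mul_sum, ← Finset.sum_sub_distrib,
    ← Finset.sum_add_distrib, ← Finset.sum_add_distrib]
  refine Finset.sum_congr rfl fun j _ => ?_
  rw [hT]
  field_simp
  ring

theorem integral_sum_sq_affine_multivariateGaussian {μ : EuclideanSpace ℝ (Fin κ)}
    {S : Matrix (Fin κ) (Fin κ) ℝ} (hS : S.PosSemidef) (W : Matrix (Fin d) (Fin κ) ℝ)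
    (r : Fin d → ℝ) :
    Integrable (fun z : EuclideanSpace ℝ (Fin κ) => ∑ j, ((W *ᵥ z.ofLp) j - r j) ^ 2)
        (multivariateGaussian μ S) ∧
      ∫ z, ∑ j, ((W *ᵥ z.ofLp) j - r j) ^ 2 ∂(multivariateGaussian μ S)
        = (W *ᵥ μ.ofLp - r) ⬝ᵥ (W *ᵥ μ.ofLp - r) + (Wᵀ * W * S).trace := by
  have hsq : ∀ (j : Fin d) (z : EuclideanSpace ℝ (Fin κ)), ((W *ᵥ z.ofLp) j - r j) ^ 2
      = (W j ⬝ᵥ z.ofLp) ^ 2 - 2 * r j * (W j ⬝ᵥ z.ofLp) + r j ^ 2 := by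
    intro j z; simp only [mulVec]; ring
  have h1 := fun j => integrable_sq_dotProduct_multivariateGaussian (μ := μ) (S := S) (W j)
  have h2 := fun j => (integrable_dotProduct_multivariateGaussian (μ := μ) (S := S) (W j)).const_mul
    (2 * r j)
  have h12 : ∀ j, Integrable (fun z : EuclideanSpace ℝ (Fin κ) =>
      (W j ⬝ᵥ z.ofLp) ^ 2 - 2 * r j * (W j ⬝ᵥ z.ofLp)) (multivariateGaussian μ S) :=
    fun j => (h1 j).sub (h2 j)
  have hint : ∀ j, Integrable (fun z : EuclideanSpace ℝ (Fin κ) =>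
      ((W *ᵥ z.ofLp) j - r j) ^ 2) (multivariateGaussian μ S) := by
    intro j
    simp_rw [hsq]
    exact (h12 j).add (integrable_const _)
  refine ⟨integrable_finsetSum _ fun j _ => hint j, ?_⟩
  rw [integral_finsetSum _ fun j _ => hint j]
  have hj : ∀ j, ∫ z, ((W *ᵥ z.ofLp) j - r j) ^ 2 ∂(multivariateGaussian μ S)
      = ((W *ᵥ μ.ofLp) j - r j) ^ 2 + (W * S * Wᵀ) j j := by
    intro j
    simp_rw [hsq]
    rw [integral_add (h12 j) (integrable_const _), integral_sub (h1 j) (h2 j),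
      integral_const_mul, integral_dotProduct_multivariateGaussian,
      integral_sq_dotProduct_multivariateGaussian hS]
    have : (W * S * Wᵀ) j j = W j ⬝ᵥ S *ᵥ W j := by
      rw [dotProduct_mulVec, mul_apply, dotProduct]
      rfl
    rw [this]
    simp
    ring
  simp_rw [hj]
  rw [Finset.sum_add_distrib, Matrix.mul_assoc Wᵀ, trace_mul_comm Wᵀ]
  simp [dotProduct, pow_two, trace]

variable (β : ℝ) (x : Fin N → Fin d → ℝ)

/-- The precision matrix of the optimal variational distributions, multiplied by the cut-off. -/
def scaledPrecision (W : Matrix (Fin d) (Fin κ) ℝ) : Matrix (Fin κ) (Fin κ) ℝ :=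
  cutOff E β • (1 : Matrix (Fin κ) (Fin κ) ℝ) + Wᵀ * W

/-- The mean of the optimal variational distribution. -/
def optMean (W : Matrix (Fin d) (Fin κ) ℝ) (b : Fin d → ℝ) (i : Fin N) : Fin κ → ℝ :=
  (scaledPrecision E β W)⁻¹ *ᵥ (Wᵀ *ᵥ (obs E x i - b))

/-- The suboptimality of a Gaussian variational distribution for the `i`-th observation. -/
def gap (W : Matrix (Fin d) (Fin κ) ℝ) (b : Fin d → ℝ) (i : Fin N)
    (μ : EuclideanSpace ℝ (Fin κ)) (S : Matrix (Fin κ) (Fin κ) ℝ) : ℝ :=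
  (cutOff E β)⁻¹ * ((μ.ofLp - optMean E β x W b i) ⬝ᵥ
      scaledPrecision E β W *ᵥ (μ.ofLp - optMean E β x W b i))
    + ((((cutOff E β)⁻¹ • scaledPrecision E β W) * S).trace - κ
        - Real.log ((cutOff E β)⁻¹ • scaledPrecision E β W).det - Real.log S.det)

variable {β}

theorem cutOff_pos (hF2 : 0 < E.F2) (hβ : 0 < β) : 0 < cutOff E β := by
  have := E.φ_pos
  unfold cutOff; positivity

theorem posDef_scaledPrecision (hF2 : 0 < E.F2) (hβ : 0 < β) (W : Matrix (Fin d) (Fin κ) ℝ) :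
    (scaledPrecision E β W).PosDef :=
  posDef_smul_one_add_transpose_mul_self W (cutOff_pos E hF2 hβ)

theorem posDef_precision (hF2 : 0 < E.F2) (hβ : 0 < β) (W : Matrix (Fin d) (Fin κ) ℝ) :
    ((cutOff E β)⁻¹ • scaledPrecision E β W).PosDef :=
  (posDef_scaledPrecision E hF2 hβ W).smul (inv_pos.2 (cutOff_pos E hF2 hβ))

theorem gap_nonneg (hF2 : 0 < E.F2) (hβ : 0 < β) (W : Matrix (Fin d) (Fin κ) ℝ) (b : Fin d → ℝ)
    (i : Fin N) (μ : EuclideanSpace ℝ (Fin κ)) {S : Matrix (Fin κ) (Fin κ) ℝ} (hS : S.PosDef) :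
    0 ≤ gap E β x W b i μ S := by
  refine add_nonneg (mul_nonneg (inv_pos.2 (cutOff_pos E hF2 hβ)).le ?_)
    (trace_mul_sub_log_det_nonneg (posDef_precision E hF2 hβ W) hS)
  exact (posDef_scaledPrecision E hF2 hβ W).quadraticForm_nonneg _

/-- The gap is a sum of two nonnegative terms, one for the mean and one for the covariance, each
with a unique zero. -/
theorem gap_eq_zero_iff (hF2 : 0 < E.F2) (hβ : 0 < β) (W : Matrix (Fin d) (Fin κ) ℝ)
    (b : Fin d → ℝ) (i : Fin N) (μ : EuclideanSpace ℝ (Fin κ)) {S : Matrix (Fin κ) (Fin κ) ℝ}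
    (hS : S.PosDef) :
    gap E β x W b i μ S = 0 ↔
      μ.ofLp = optMean E β x W b i ∧ S = ((cutOff E β)⁻¹ • scaledPrecision E β W)⁻¹ := by
  have hc := inv_pos.2 (cutOff_pos E hF2 hβ)
  have hP := posDef_scaledPrecision E hF2 hβ W
  rw [gap, add_eq_zero_iff_of_nonneg (mul_nonneg hc.le (hP.quadraticForm_nonneg _))
    (trace_mul_sub_log_det_nonneg (posDef_precision E hF2 hβ W) hS),
    trace_mul_sub_log_det_eq_zero_iff (posDef_precision E hF2 hβ W) hS,
    mul_eq_zero_iff_left hc.ne', hP.quadraticForm_eq_zero_iff, sub_eq_zero]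

theorem matC_eq (hβ : 0 < β) (W : Matrix (Fin d) (Fin κ) ℝ) :
    matC E β W = β⁻¹ • (cutOff E β • (1 : Matrix (Fin d) (Fin d) ℝ) + W * Wᵀ) := by
  rw [matC, cutOff, smul_add, smul_smul]
  congr 2
  field_simp

theorem inv_matC (hF2 : 0 < E.F2) (hβ : 0 < β) (W : Matrix (Fin d) (Fin κ) ℝ) :
    (matC E β W)⁻¹ = β • (cutOff E β • (1 : Matrix (Fin d) (Fin d) ℝ) + W * Wᵀ)⁻¹ := by
  have h := (posDef_smul_one_add_mul_transpose_self W (cutOff_pos E hF2 hβ)).det_pos.ne'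
  rw [matC_eq E hβ]
  refine inv_eq_right_inv ?_
  rw [smul_mul_smul_comm, inv_mul_cancel₀ hβ.ne', mul_nonsing_inv _ (isUnit_iff_ne_zero.2 h),
    one_smul]

theorem log_det_matC (hF2 : 0 < E.F2) (hβ : 0 < β) (W : Matrix (Fin d) (Fin κ) ℝ) :
    Real.log (matC E β W).det
      = Real.log (cutOff E β • (1 : Matrix (Fin d) (Fin d) ℝ) + W * Wᵀ).det - d * Real.log β := by
  have h := (posDef_smul_one_add_mul_transpose_self W (cutOff_pos E hF2 hβ)).det_pos.ne'
  rw [matC_eq E hβ, det_smul, Real.log_mul (by positivity) h, Fintype.card_fin, Real.log_pow,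
    Real.log_inv]
  ring

theorem trace_mul_matS (A : Matrix (Fin d) (Fin d) ℝ) (b : Fin d → ℝ) :
    (A * matS E x b).trace
      = (N : ℝ)⁻¹ * ∑ i, (obs E x i - b) ⬝ᵥ A *ᵥ (obs E x i - b) := by
  rw [matS, Matrix.mul_smul, trace_smul, Matrix.mul_sum, trace_sum, smul_eq_mul]
  congr 1
  refine Finset.sum_congr rfl fun i _ => ?_
  rw [mul_vecMulVec, trace_vecMulVec, dotProduct_comm]

/-- The evidence decomposition. The factor F''(0)/φ of the quadratic loss is β divided by the
cut-off, so loss and divergence combine into one regularized least squares problem per observation,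
whose optimal value involves C⁻¹ and log|C|. -/
theorem jointObjective_eq (hF2 : 0 < E.F2) (hβ : 0 < β) (hN : 0 < N)
    (W : Matrix (Fin d) (Fin κ) ℝ) (b : Fin d → ℝ)
    (μ : Fin N → EuclideanSpace ℝ (Fin κ)) (Sig : Fin N → Matrix (Fin κ) (Fin κ) ℝ)
    (hSig : ∀ i, (Sig i).PosDef) :
    jointObjective E β x W b μ Sig
      = approxObjective E β x W b - (N : ℝ)⁻¹ * ∑ i, β / 2 * gap E β x W b i (μ i) (Sig i) := by
  have hφ := E.φ_pos
  have hc := cutOff_pos E hF2 hβ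
  have hN' : (N : ℝ) ≠ 0 := by positivity
  set C := cutOff E β • (1 : Matrix (Fin d) (Fin d) ℝ) + W * Wᵀ with hC
  have hlog : Real.log C.det = d * Real.log (cutOff E β)
      + Real.log ((cutOff E β)⁻¹ • scaledPrecision E β W).det := by
    rw [hC, det_smul_one_add_mul_transpose_self W hc, ← scaledPrecision,
      Real.log_mul (by positivity) (posDef_precision E hF2 hβ W).det_pos.ne', Real.log_pow]
  have hlogc : Real.log (cutOff E β) = Real.log β - Real.log (E.φ⁻¹ * E.F2) := by
    rw [← Real.log_div hβ.ne' (by positivity)]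
    congr 1
    rw [cutOff]; field_simp
  have key : ∀ i, (∫ z, E.logLikTaylor (x i) (W *ᵥ z.ofLp + b)
        ∂(multivariateGaussian (μ i) (Sig i)))
      - β * (klDiv (multivariateGaussian (μ i) (Sig i))
          (stdGaussian (EuclideanSpace ℝ (Fin κ)))).toReal
      = -(1 / 2) * ((obs E x i - b) ⬝ᵥ (matC E β W)⁻¹ *ᵥ (obs E x i - b)
          + β * Real.log (matC E β W).det + β * d * Real.log (E.φ⁻¹ * E.F2)
          + (2 * d / E.φ * E.F0 - (1 / (E.F2 * E.φ) * ∑ j, (x i j - E.F1) ^ 2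
            + 2 * ∑ j, E.K (x i j) E.φ)))
        - β / 2 * gap E β x W b i (μ i) (Sig i) := by
    intro i
    obtain ⟨hI, hIv⟩ := integral_sum_sq_affine_multivariateGaussian (μ := μ i)
      (hSig i).posSemidef W (obs E x i - b)
    have h1 : ∀ z : EuclideanSpace ℝ (Fin κ),
        ∑ j, ((W *ᵥ z.ofLp + b) j - E.F2⁻¹ * (x i j - E.F1)) ^ 2
          = ∑ j, ((W *ᵥ z.ofLp) j - (obs E x i - b) j) ^ 2 := by
      intro z
      refine Finset.sum_congr rfl fun j _ => ?_
      simp only [Pi.add_apply, Pi.sub_apply, obs]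
      ring
    simp_rw [E.logLikTaylor_eq hF2, h1]
    rw [integral_add (hI.const_mul _) (integrable_const _), integral_const_mul, hIv,
      toReal_klDiv_multivariateGaussian_stdGaussian (hSig i), integral_const]
    have hsq := sq_norm_sub_add_smul_sq_norm W hc (obs E x i - b) (μ i).ofLp
    rw [← hC] at hsq
    have htr : (((cutOff E β)⁻¹ • scaledPrecision E β W) * Sig i).trace
        = (Sig i).trace + (cutOff E β)⁻¹ * (Wᵀ * W * Sig i).trace := by
      rw [scaledPrecision, smul_add, smul_smul, inv_mul_cancel₀ hc.ne', one_smul, Matrix.add_mul,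
        Matrix.one_mul, trace_add, Matrix.smul_mul, trace_smul, smul_eq_mul]
    rw [gap, htr, log_det_matC E hF2 hβ, inv_matC E hF2 hβ, ← hC, hlog, hlogc, smul_mulVec,
      dotProduct_smul, smul_eq_mul]
    have hcc : (cutOff E β)⁻¹ = E.F2 / E.φ / β := by rw [cutOff]; field_simp
    -- The completed square solved for ‖μ‖², the form in which it enters the divergence.
    have hsq2 : (μ i).ofLp ⬝ᵥ (μ i).ofLp = (cutOff E β)⁻¹ *
        (((μ i).ofLp - optMean E β x W b i) ⬝ᵥ
          scaledPrecision E β W *ᵥ ((μ i).ofLp - optMean E β x W b i)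
        - (W *ᵥ (μ i).ofLp - (obs E x i - b)) ⬝ᵥ (W *ᵥ (μ i).ofLp - (obs E x i - b)))
        + (obs E x i - b) ⬝ᵥ C⁻¹ *ᵥ (obs E x i - b) := by
      have : ∀ p q r s : ℝ, p + cutOff E β * q = r + cutOff E β * s →
          q = (cutOff E β)⁻¹ * (r - p) + s := by
        intro p q r s h
        field_simp
        linarith
      exact this _ _ _ _ hsq
    rw [hsq2, hcc]
    simp only [probReal_univ]
    field_simp
    ring
  rw [jointObjective, Finset.sum_congr rfl fun i _ => key i, Finset.sum_sub_distrib, mul_sub,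
    approxObjective, constD, trace_mul_matS]
  congr 1
  simp only [← Finset.mul_sum, Finset.sum_add_distrib, Finset.sum_sub_distrib, Finset.sum_const,
    Finset.card_univ, Fintype.card_fin, nsmul_eq_mul]
  field_simp

theorem isGreatest_approxObjective (hF2 : 0 < E.F2) (hβ : 0 < β) (hN : 0 < N)
    (W : Matrix (Fin d) (Fin κ) ℝ) (b : Fin d → ℝ) :
    IsGreatest ((fun p => jointObjective E β x W b p.1 p.2) '' varParams N κ)
      (approxObjective E β x W b) := by
  constructor
  · have hpd := (posDef_precision E hF2 hβ W).inv
    refine ⟨(fun i => WithLp.toLp 2 (optMean E β x W b i),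
      fun _ => ((cutOff E β)⁻¹ • scaledPrecision E β W)⁻¹), fun _ => hpd, ?_⟩
    dsimp only
    rw [jointObjective_eq E x hF2 hβ hN W b _ _ fun _ => hpd]
    simp [(gap_eq_zero_iff E x hF2 hβ W b _ (WithLp.toLp 2 (optMean E β x W b _)) hpd).2 ⟨rfl, rfl⟩]
  · rintro _ ⟨p, hp, rfl⟩
    dsimp only
    rw [jointObjective_eq E x hF2 hβ hN W b _ _ hp, sub_le_self_iff]
    exact mul_nonneg (by positivity) (Finset.sum_nonneg fun i _ =>
      mul_nonneg (by positivity) (gap_nonneg E x hF2 hβ W b i _ (hp i)))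

/-- The optimal variational parameters are unique. -/
theorem isMaxOn_jointObjective_iff (hF2 : 0 < E.F2) (hβ : 0 < β) (hN : 0 < N)
    (W : Matrix (Fin d) (Fin κ) ℝ) (b : Fin d → ℝ)
    {p : (Fin N → EuclideanSpace ℝ (Fin κ)) × (Fin N → Matrix (Fin κ) (Fin κ) ℝ)}
    (hp : p ∈ varParams N κ) :
    IsMaxOn (fun q => jointObjective E β x W b q.1 q.2) (varParams N κ) p ↔
      ∀ i, p.1 i = WithLp.toLp 2 (optMean E β x W b i) ∧
        p.2 i = ((cutOff E β)⁻¹ • scaledPrecision E β W)⁻¹ := by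
  have hg := isGreatest_approxObjective E x hF2 hβ hN W b
  have h1 : IsMaxOn (fun q => jointObjective E β x W b q.1 q.2) (varParams N κ) p ↔
      jointObjective E β x W b p.1 p.2 = approxObjective E β x W b := by
    constructor
    · intro h
      obtain ⟨q, hq, hq'⟩ := hg.1
      exact le_antisymm (hg.2 ⟨p, hp, rfl⟩) (hq' ▸ h hq)
    · intro h q hq
      have := hg.2 ⟨q, hq, rfl⟩
      simpa [h] using this
  have hN' : (N : ℝ)⁻¹ ≠ 0 := by positivity
  rw [h1, jointObjective_eq E x hF2 hβ hN W b _ _ hp, sub_eq_self, mul_eq_zero_iff_left hN',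
    Finset.sum_eq_zero_iff_of_nonneg fun i _ =>
      mul_nonneg (by positivity) (gap_nonneg E x hF2 hβ W b i _ (hp i))]
  refine forall_congr' fun i => ?_
  rw [mul_eq_zero_iff_left (by positivity), gap_eq_zero_iff E x hF2 hβ W b i _ (hp i)]
  simp only [Finset.mem_univ, true_imp_iff]
  refine and_congr_left fun _ => ⟨fun h => by rw [← h], fun h => by rw [h]⟩

end JointObjective

/-! ### The scalar cost log y + s / y on y ≥ c -/

section Cost

/-- Quantitative optimality with k = max s c: the excess cost is k/y - 1 - log(k/y) plus (k - s)(1/k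
- 1/y). The last product is nonnegative because either k = s, or k = c ≤ y. -/
theorem log_max_add_div_add_le {c s y : ℝ} (hc : 0 < c) (hy : c ≤ y) :
    Real.log (max s c) + s / max s c + (max s c / y - 1 - Real.log (max s c / y))
      ≤ Real.log y + s / y := by
  have hk : 0 < max s c := lt_max_of_lt_right hc
  have hy0 : 0 < y := hc.trans_le hy
  have h2 : (max s c - s) * (1 / max s c - 1 / y) ≥ 0 := by
    rcases le_total s c with h | h
    · rw [max_eq_right h]
      exact mul_nonneg (sub_nonneg.2 h) (sub_nonneg.2 (one_div_le_one_div_of_le hc hy))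
    · simp [max_eq_left h]
  have h3 : (max s c - s) * (1 / max s c - 1 / y)
      = 1 - s / max s c - max s c / y + s / y := by
    field_simp; ring
  rw [Real.log_div hk.ne' hy0.ne']
  linarith

/-- The cost `log y + s / y` is minimal over `y ≥ c` at `y = max s c`. -/
theorem log_max_add_div_le {c s y : ℝ} (hc : 0 < c) (hy : c ≤ y) :
    Real.log (max s c) + s / max s c ≤ Real.log y + s / y := by
  have h := log_max_add_div_add_le (s := s) hc hy
  have h1 := Real.log_le_sub_one_of_pos
    (div_pos (lt_max_of_lt_right hc : 0 < max s c) (hc.trans_le hy))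
  linarith

theorem eq_max_of_log_add_div_le {c s y : ℝ} (hc : 0 < c) (hy : c ≤ y)
    (h : Real.log y + s / y ≤ Real.log (max s c) + s / max s c) : y = max s c := by
  have hy0 : 0 < y := hc.trans_le hy
  by_contra hne
  have h1 := Real.log_lt_sub_one_of_pos (div_pos (lt_max_of_lt_right hc : 0 < max s c) hy0)
    (fun h => hne ((div_eq_one_iff_eq hy0.ne').1 h).symm)
  have h2 := log_max_add_div_add_le (s := s) hc hy
  linarith

/-- The saving of the optimal choice `y = max s c` over `y = c` increases with `s`. -/
theorem monotone_cost_saving {c : ℝ} (hc : 0 < c) :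
    Monotone fun s => Real.log c + s / c - (Real.log (max s c) + s / max s c) := by
  intro s s' h
  have h1 := log_max_add_div_le (s := s') hc (le_max_right s c)
  have h2 : (s' - s) * (1 / c - 1 / max s c) ≥ 0 :=
    mul_nonneg (sub_nonneg.2 h) (sub_nonneg.2 (one_div_le_one_div_of_le hc (le_max_right s c)))
  have h3 : (s' - s) * (1 / c - 1 / max s c)
      = s' / c - s / c - s' / max s c + s / max s c := by ring
  dsimp only
  linarith

end Cost

/-! ### Rearrangement for doubly stochastic weights -/

section DoublyStochastic

variable {n : ℕ}

/-- By Birkhoff's theorem the weights are a convex combination of permutation matrices, and the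
rearrangement inequality applies to each permutation. -/
theorem sum_mul_le_sum_doublyStochastic {f g : Fin n → ℝ} (hfg : Antivary f g)
    {P : Matrix (Fin n) (Fin n) ℝ} (hP : P ∈ doublyStochastic ℝ (Fin n)) :
    ∑ i, f i * g i ≤ ∑ i, ∑ j, P i j * (f i * g j) := by
  obtain ⟨w, hw, hw1, rfl⟩ := exists_eq_sum_perm_of_mem_doublyStochastic hP
  have h : ∑ i, ∑ j, (∑ σ, w σ • σ.permMatrix ℝ) i j * (f i * g j)
      = ∑ σ, w σ * ∑ i, f i * g (σ i) := by
    simp only [Matrix.sum_apply, Finset.sum_mul, Finset.mul_sum]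
    rw [Finset.sum_congr rfl fun i _ => Finset.sum_comm, Finset.sum_comm]
    refine Finset.sum_congr rfl fun σ _ => Finset.sum_congr rfl fun i _ => ?_
    rw [Finset.sum_eq_single (σ i)]
    · simp [Equiv.Perm.permMatrix, PEquiv.toMatrix_apply]
    · intro j _ hj
      simp [Equiv.Perm.permMatrix, PEquiv.toMatrix_apply, hj.symm]
    · simp
  rw [h]
  calc ∑ i, f i * g i = ∑ σ, w σ * ∑ i, f i * g i := by rw [← Finset.sum_mul, hw1, one_mul]
    _ ≤ _ := Finset.sum_le_sum fun σ _ =>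
      mul_le_mul_of_nonneg_left hfg.sum_mul_le_sum_mul_comp_perm (hw σ)

theorem sq_mem_doublyStochastic {Q : Matrix (Fin n) (Fin n) ℝ} (h1 : Qᵀ * Q = 1)
    (h2 : Q * Qᵀ = 1) : (of fun i j => Q i j ^ 2) ∈ doublyStochastic ℝ (Fin n) := by
  rw [mem_doublyStochastic_iff_sum]
  refine ⟨fun i j => sq_nonneg _, fun i => ?_, fun j => ?_⟩
  · have := congrFun (congrFun h2 i) i
    simpa [mul_apply, pow_two] using this
  · have := congrFun (congrFun h1 j) j
    simpa [mul_apply, pow_two] using this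

end DoublyStochastic

/-! ### Minimizers of the probabilistic PCA loss -/

section PPCA

variable {d κ : ℕ} {c : ℝ}

/-- Up to constants, the negative log-likelihood of probabilistic principal component analysis with
known noise level `c` and sample covariance `S`. -/
def ppcaLoss (c : ℝ) (S : Matrix (Fin d) (Fin d) ℝ) (W : Matrix (Fin d) (Fin κ) ℝ) : ℝ :=
  ((c • (1 : Matrix (Fin d) (Fin d) ℝ) + W * Wᵀ)⁻¹ * S).trace
    + Real.log (c • (1 : Matrix (Fin d) (Fin d) ℝ) + W * Wᵀ).det

/-- The minimum of `ppcaLoss`, in terms of the eigenvalues of `S`. -/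
def ppcaMin (κ : ℕ) (c : ℝ) (lam : Fin d → ℝ) : ℝ :=
  ∑ j : Fin d, if (j : ℕ) < κ then Real.log (max (lam j) c) + lam j / max (lam j) c
    else Real.log c + lam j / c

/-- `W * Wᵀ` is diagonalized by an orthogonal matrix, with at most `κ` nonzero eigenvalues. -/
theorem exists_diagonalization_mul_transpose_self (W : Matrix (Fin d) (Fin κ) ℝ) :
    ∃ (U : Matrix (Fin d) (Fin d) ℝ) (l : Fin d → ℝ), Uᵀ * U = 1 ∧ U * Uᵀ = 1 ∧ Antitone l ∧
      (∀ j, 0 ≤ l j) ∧ (∀ j : Fin d, κ ≤ (j : ℕ) → l j = 0) ∧ W * Wᵀ = U * diagonal l * Uᵀ := by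
  have hpsd : (W * Wᵀ).PosSemidef := by
    have := posSemidef_self_mul_conjTranspose W
    rwa [conjTranspose_eq_transpose_of_trivial] at this
  obtain ⟨U, h1, h2, h3⟩ := exists_orthogonal_diagonalization hpsd.1
  set l := fun j => hpsd.1.eigenvalues₀ (Fin.cast (Fintype.card_fin d).symm j) with hl
  have hanti : Antitone l := antitone_eigenvalues₀_cast hpsd.1
  have hdiag : diagonal l = Uᵀ * (W * Wᵀ) * U := by
    rw [h3]
    simp only [Matrix.mul_assoc, h1, Matrix.mul_one]
    rw [← Matrix.mul_assoc, h1, Matrix.one_mul]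
  have hnn : ∀ j, 0 ≤ l j := by
    have : (diagonal l).PosSemidef := by
      rw [hdiag]
      simpa using hpsd.conjTranspose_mul_mul_same U
    exact posSemidef_diagonal_iff.1 this
  refine ⟨U, l, h1, h2, hanti, hnn, fun j hj => ?_, h3⟩
  by_contra hne
  have hpos : 0 < l j := lt_of_le_of_ne (hnn j) (Ne.symm hne)
  have hrank : (diagonal l).rank ≤ κ := by
    rw [hdiag]
    calc _ ≤ (Uᵀ * (W * Wᵀ)).rank := rank_mul_le_left _ _
      _ ≤ (W * Wᵀ).rank := rank_mul_le_right _ _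
      _ ≤ W.rank := rank_mul_le_left _ _
      _ ≤ κ := by simpa using W.rank_le_card_width
  rw [rank_diagonal] at hrank
  -- As `l` is decreasing, `l j > 0` makes the entries 0, …, j nonzero: j + 1 > κ of them, more than
  -- the rank allows.
  let f : Fin ((j : ℕ) + 1) → {i // l i ≠ 0} := fun i =>
    ⟨⟨i, by omega⟩, (hpos.trans_le (hanti (by
      rw [Fin.le_def]; simpa using Nat.lt_succ_iff.1 i.2))).ne'⟩
  have hf : Function.Injective f := fun a b h => by
    simpa [f, Fin.ext_iff] using h
  have := Fintype.card_le_of_injective f hf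
  rw [Fintype.card_fin] at this
  omega

variable {S V U : Matrix (Fin d) (Fin d) ℝ} {lam l : Fin d → ℝ} {W : Matrix (Fin d) (Fin κ) ℝ}

theorem transpose_mul_orthogonal (hU : Uᵀ * U = 1) (hV' : V * Vᵀ = 1) :
    (Vᵀ * U)ᵀ * (Vᵀ * U) = 1 := by
  rw [transpose_mul, transpose_transpose, Matrix.mul_assoc, ← Matrix.mul_assoc V, hV',
    Matrix.one_mul, hU]

/-- The trace produces the weights (VᵀU)_ij². The log-determinant, a sum over j only, can be spread
over i because each column of weights sums to 1. The loss thereby becomes linear in the weights. -/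
theorem ppcaLoss_eq (hc : 0 < c) (hU : Uᵀ * U = 1) (hU' : U * Uᵀ = 1) (hl : ∀ j, 0 ≤ l j)
    (hW : W * Wᵀ = U * diagonal l * Uᵀ) (hV' : V * Vᵀ = 1)
    (hS : S = V * diagonal lam * Vᵀ) :
    ppcaLoss c S W = ∑ i, ∑ j, (Vᵀ * U) i j ^ 2 * (Real.log (c + l j) + lam i / (c + l j)) := by
  have hpos : ∀ j, 0 < c + l j := fun j => add_pos_of_pos_of_nonneg hc (hl j)
  have h1 : c • (1 : Matrix (Fin d) (Fin d) ℝ) + W * Wᵀ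
      = U * diagonal (fun j => c + l j) * Uᵀ := by
    rw [hW, ← diagonal_add, Matrix.mul_add, Matrix.add_mul]
    congr 1
    rw [← smul_one_eq_diagonal, Matrix.mul_smul, Matrix.smul_mul, Matrix.mul_one, hU']
  have h2 : (U * diagonal (fun j => c + l j) * Uᵀ)⁻¹
      = U * diagonal (fun j => (c + l j)⁻¹) * Uᵀ := by
    refine inv_eq_right_inv ?_
    calc _ = U * diagonal (fun j => c + l j) * (Uᵀ * U) * diagonal (fun j => (c + l j)⁻¹) * Uᵀ := by
          simp only [Matrix.mul_assoc]
      _ = U * (diagonal (fun j => c + l j) * diagonal (fun j => (c + l j)⁻¹)) * Uᵀ := by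
          rw [hU, Matrix.mul_one, Matrix.mul_assoc U]
      _ = 1 := by
          rw [diagonal_mul_diagonal]
          simp [mul_inv_cancel₀ (hpos _).ne', hU']
  have hdet : (U * diagonal (fun j => c + l j) * Uᵀ).det = ∏ j, (c + l j) := by
    rw [det_mul_right_comm, hU', Matrix.one_mul, det_diagonal]
  have htr : (U * diagonal (fun j => (c + l j)⁻¹) * Uᵀ * S).trace
      = ∑ i, ∑ j, (Vᵀ * U) i j ^ 2 * (lam i / (c + l j)) := by
    have : (U * diagonal (fun j => (c + l j)⁻¹) * Uᵀ * S).trace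
        = (diagonal lam * ((Vᵀ * U) * diagonal (fun j => (c + l j)⁻¹) * (Vᵀ * U)ᵀ)).trace := by
      rw [hS, trace_mul_comm]
      rw [Matrix.mul_assoc V, Matrix.mul_assoc V, trace_mul_comm V]
      simp only [transpose_mul, transpose_transpose, Matrix.mul_assoc]
    rw [this, trace]
    refine Finset.sum_congr rfl fun i _ => ?_
    rw [diag_apply, diagonal_mul, mul_apply, Finset.mul_sum]
    refine Finset.sum_congr rfl fun j _ => ?_
    rw [mul_diagonal, transpose_apply]
    ring
  have hQ := sq_mem_doublyStochastic (transpose_mul_orthogonal hU hV')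
    (mul_eq_one_comm.1 (transpose_mul_orthogonal hU hV'))
  have hlog : ∑ j, Real.log (c + l j) = ∑ i, ∑ j, (Vᵀ * U) i j ^ 2 * Real.log (c + l j) := by
    rw [Finset.sum_comm]
    refine Finset.sum_congr rfl fun j _ => ?_
    have := sum_col_of_mem_doublyStochastic hQ j
    simp only [of_apply] at this
    rw [← Finset.sum_mul, this, one_mul]
  rw [ppcaLoss, h1, h2, hdet, htr, Real.log_prod fun j _ => (hpos j).ne', hlog, add_comm,
    ← Finset.sum_add_distrib]
  simp only [← Finset.sum_add_distrib, mul_add]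

/-- A separable cost sees only the marginals of the weights; this evaluates the dual potentials. -/
theorem sum_sum_mul_add_of_doublyStochastic {P : Matrix (Fin d) (Fin d) ℝ}
    (hP : P ∈ doublyStochastic ℝ (Fin d)) (α γ : Fin d → ℝ) :
    ∑ i, ∑ j, P i j * (α i + γ j) = ∑ j, (α j + γ j) := by
  simp only [mul_add, Finset.sum_add_distrib]
  congr 1
  · exact Finset.sum_congr rfl fun i _ => by
      rw [← Finset.sum_mul, sum_row_of_mem_doublyStochastic hP, one_mul]
  · rw [Finset.sum_comm]
    exact Finset.sum_congr rfl fun j _ => by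
      rw [← Finset.sum_mul, sum_col_of_mem_doublyStochastic hP, one_mul]

/-- A lower bound for the loss by the rearrangement inequality. -/
theorem sum_le_ppcaLoss (hc : 0 < c) (hU : Uᵀ * U = 1) (hU' : U * Uᵀ = 1) (hlam : Antitone lam)
    (hla : Antitone l) (hl : ∀ j, 0 ≤ l j) (hW : W * Wᵀ = U * diagonal l * Uᵀ)
    (hV' : V * Vᵀ = 1) (hS : S = V * diagonal lam * Vᵀ) :
    ∑ j, (Real.log (c + l j) + lam j / (c + l j)) ≤ ppcaLoss c S W := by
  have hpos : ∀ j, 0 < c + l j := fun j => add_pos_of_pos_of_nonneg hc (hl j)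
  have hQ := sq_mem_doublyStochastic (transpose_mul_orthogonal hU hV')
    (mul_eq_one_comm.1 (transpose_mul_orthogonal hU hV'))
  have hmono : Monotone fun j => (c + l j)⁻¹ := fun i j h =>
    inv_anti₀ (hpos j) (by linarith [hla h])
  have h1 := sum_mul_le_sum_doublyStochastic (hlam.antivary hmono) hQ
  have h2 := sum_sum_mul_add_of_doublyStochastic hQ (fun _ => 0) (fun j => Real.log (c + l j))
  simp only [zero_add] at h2
  rw [ppcaLoss_eq hc hU hU' hl hW hV' hS]
  simp only [mul_add, Finset.sum_add_distrib, div_eq_mul_inv]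
  simp only [of_apply] at h1 h2
  rw [h2]
  linarith

theorem ppcaMin_le_sum (hc : 0 < c) (hl : ∀ j, 0 ≤ l j)
    (hl0 : ∀ j : Fin d, κ ≤ (j : ℕ) → l j = 0) :
    ppcaMin κ c lam ≤ ∑ j, (Real.log (c + l j) + lam j / (c + l j)) := by
  refine Finset.sum_le_sum fun j _ => ?_
  split_ifs with h
  · exact log_max_add_div_le hc (le_add_of_nonneg_right (hl j))
  · rw [hl0 j (not_lt.1 h), add_zero]

theorem ppcaMin_le_ppcaLoss (hc : 0 < c) (hlam : Antitone lam)
    (hV' : V * Vᵀ = 1) (hS : S = V * diagonal lam * Vᵀ) (W : Matrix (Fin d) (Fin κ) ℝ) :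
    ppcaMin κ c lam ≤ ppcaLoss c S W := by
  obtain ⟨U, l, hU, hU', hla, hl, hl0, hW⟩ := exists_diagonalization_mul_transpose_self W
  exact (ppcaMin_le_sum hc hl hl0).trans (sum_le_ppcaLoss hc hU hU' hlam hla hl hW hV' hS)

/-- The nonzero eigenvalues of `W * Wᵀ` at a minimizer `W` of the loss. -/
theorem eigenvalue_of_ppcaLoss_le (hc : 0 < c) (hU : Uᵀ * U = 1) (hU' : U * Uᵀ = 1)
    (hlam : Antitone lam) (hla : Antitone l) (hl : ∀ j, 0 ≤ l j)
    (hl0 : ∀ j : Fin d, κ ≤ (j : ℕ) → l j = 0) (hW : W * Wᵀ = U * diagonal l * Uᵀ)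
    (hV' : V * Vᵀ = 1) (hS : S = V * diagonal lam * Vᵀ)
    (hmin : ppcaLoss c S W ≤ ppcaMin κ c lam) (j : Fin d) (hj : (j : ℕ) < κ) :
    c + l j = max (lam j) c := by
  have h1 := le_antisymm (ppcaMin_le_sum (lam := lam) hc hl hl0)
    ((sum_le_ppcaLoss hc hU hU' hlam hla hl hW hV' hS).trans hmin)
  -- Equality of the sums forces equality in each termwise bound.
  have h2 := (Finset.sum_eq_sum_iff_of_le fun j _ => by
    split_ifs with h
    · exact log_max_add_div_le hc (le_add_of_nonneg_right (hl j))
    · rw [hl0 j (not_lt.1 h), add_zero]).1 h1 j (Finset.mem_univ j)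
  rw [if_pos hj] at h2
  exact eq_max_of_log_add_div_le hc (le_add_of_nonneg_right (hl j)) h2.ge

/-- At a minimizer `W` of the loss, the eigenvectors of `W * Wᵀ` are orthogonal to all
eigenvectors of `S` with a different (truncated) eigenvalue. -/
theorem max_eq_of_ppcaLoss_le (hc : 0 < c) (hU : Uᵀ * U = 1) (hU' : U * Uᵀ = 1)
    (hlam : Antitone lam) (hl : ∀ j, 0 ≤ l j)
    (hl0 : ∀ j : Fin d, κ ≤ (j : ℕ) → l j = 0) (hW : W * Wᵀ = U * diagonal l * Uᵀ)
    (hV' : V * Vᵀ = 1) (hS : S = V * diagonal lam * Vᵀ) (hκ : κ ≤ d)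
    (hmin : ppcaLoss c S W ≤ ppcaMin κ c lam) (i j : Fin d) (hj : (j : ℕ) < κ)
    (hij : (Vᵀ * U) i j ≠ 0) : c + l j = max (lam i) c := by
  have hQ := sq_mem_doublyStochastic (transpose_mul_orthogonal hU hV')
    (mul_eq_one_comm.1 (transpose_mul_orthogonal hU hV'))
  set mc : ℝ → ℝ := fun s => Real.log (max s c) + s / max s c with hmc
  set sv : ℝ → ℝ := fun s => Real.log c + s / c - mc s with hsv
  have hsvm : Monotone sv := monotone_cost_saving hc
  -- The price of one of the κ free slots: the saving at the κ-th largest eigenvalue, which has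
  -- index κ - 1 when counted from 0. `hj` ensures κ > 0.
  set q := sv (lam ⟨κ - 1, by omega⟩)
  -- Dual potentials of the assignment problem: each eigenvalue pays its cost at y = c, reduced by
  -- what its saving exceeds the price, and each free slot contributes -q.
  set α : Fin d → ℝ := fun i => Real.log c + lam i / c - max (sv (lam i) - q) 0 with hα
  set γ : Fin d → ℝ := fun j => if (j : ℕ) < κ then -q else 0 with hγ
  have hle : ∀ i j : Fin d, (j : ℕ) < κ → α i + γ j ≤ mc (lam i) := by
    intro i j hj
    have := le_max_left (sv (lam i) - q) 0
    simp only [hα, hγ, if_pos hj]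
    simp only [hsv] at this ⊢
    linarith
  have hdual : ∀ i j : Fin d, α i + γ j ≤ Real.log (c + l j) + lam i / (c + l j) := by
    intro i j
    by_cases hj : (j : ℕ) < κ
    · exact (hle i j hj).trans (log_max_add_div_le hc (le_add_of_nonneg_right (hl j)))
    · have := le_max_right (sv (lam i) - q) 0
      simp only [hα, hγ, if_neg hj, hl0 j (not_lt.1 hj), add_zero]
      linarith
  have hsum : ∑ j, (α j + γ j) = ppcaMin κ c lam := by
    refine Finset.sum_congr rfl fun j _ => ?_
    split_ifs with h
    · have h1 : q ≤ sv (lam j) := hsvm (hlam (by rw [Fin.le_def]; simp; omega))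
      simp only [hα, hγ, if_pos h, max_eq_left (sub_nonneg.2 h1)]
      simp only [hsv]
      ring
    · have h1 : sv (lam j) ≤ q := hsvm (hlam (by rw [Fin.le_def]; simp; omega))
      simp only [hα, hγ, if_neg h, max_eq_right (sub_nonpos.2 h1)]
      ring
  -- Complementary slackness: the dual value is `ppcaMin`, so the nonnegative slacks have total
  -- weight zero, and slack vanishes wherever the weight does not.
  have htot : ∑ i, ∑ j, (Vᵀ * U) i j ^ 2 *
      ((Real.log (c + l j) + lam i / (c + l j)) - (α i + γ j)) ≤ 0 := by
    simp only [mul_sub, Finset.sum_sub_distrib]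
    have h1 := sum_sum_mul_add_of_doublyStochastic hQ α γ
    simp only [of_apply] at h1
    rw [h1, hsum, ← ppcaLoss_eq hc hU hU' hl hW hV' hS]
    linarith
  have hnn : ∀ i j, 0 ≤ (Vᵀ * U) i j ^ 2 *
      ((Real.log (c + l j) + lam i / (c + l j)) - (α i + γ j)) := fun i j =>
    mul_nonneg (sq_nonneg _) (sub_nonneg.2 (hdual i j))
  have h0 := le_antisymm htot (Finset.sum_nonneg fun i _ => Finset.sum_nonneg fun j _ => hnn i j)
  rw [Finset.sum_eq_zero_iff_of_nonneg fun i _ => Finset.sum_nonneg fun j _ => hnn i j] at h0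
  have h1 := h0 i (Finset.mem_univ i)
  rw [Finset.sum_eq_zero_iff_of_nonneg fun j _ => hnn i j] at h1
  have h2 := h1 j (Finset.mem_univ j)
  rw [mul_eq_zero_iff_left (pow_ne_zero 2 hij), sub_eq_zero] at h2
  exact eq_max_of_log_add_div_le hc (le_add_of_nonneg_right (hl j)) (h2.trans_le (hle i j hj))

/-- The columns of `U` are orthonormal, and the `j`-th one is an eigenvector of `S` for the
eigenvalue `lam j`. -/
def IsEigenframe (S : Matrix (Fin d) (Fin d) ℝ) (lam : Fin κ → ℝ)
    (U : Matrix (Fin d) (Fin κ) ℝ) : Prop :=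
  Uᵀ * U = 1 ∧ S * U = U * diagonal lam

theorem isEigenframe_submatrix (hκ : κ ≤ d) (hV : Vᵀ * V = 1)
    (hS : S = V * diagonal lam * Vᵀ) :
    IsEigenframe S (fun j => lam (Fin.castLE hκ j)) (V.submatrix id (Fin.castLE hκ)) := by
  have hSV : S * V = V * diagonal lam := by
    rw [hS, Matrix.mul_assoc, hV, Matrix.mul_one]
  constructor
  · rw [transpose_submatrix, ← submatrix_mul _ _ _ id _ Function.bijective_id, hV,
      submatrix_one _ (Fin.castLE_injective hκ)]
  · ext i j
    have := congrFun (congrFun hSV i) (Fin.castLE hκ j)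
    rw [mul_diagonal] at this ⊢
    simpa [mul_apply] using this

/-- For a minimizer `W` of the loss, the matrix `W * Wᵀ` is determined by leading eigenvectors of
`S`. -/
theorem exists_isEigenframe_of_ppcaLoss_le (hc : 0 < c) (hlam : Antitone lam) (hκ : κ ≤ d)
    (hV : Vᵀ * V = 1) (hV' : V * Vᵀ = 1) (hS : S = V * diagonal lam * Vᵀ)
    (hmin : ppcaLoss c S W ≤ ppcaMin κ c lam) :
    ∃ X : Matrix (Fin d) (Fin κ) ℝ, IsEigenframe S (fun j => lam (Fin.castLE hκ j)) X ∧
      W * Wᵀ = X * diagonal (fun j => max (lam (Fin.castLE hκ j)) c - c) * Xᵀ := by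
  obtain ⟨U, l, hU, hU', hla, hl, hl0, hW⟩ := exists_diagonalization_mul_transpose_self W
  have hev := eigenvalue_of_ppcaLoss_le hc hU hU' hlam hla hl hl0 hW hV' hS hmin
  have hort := max_eq_of_ppcaLoss_le hc hU hU' hlam hl hl0 hW hV' hS hκ hmin
  have hUV : U = V * (Vᵀ * U) := by rw [← Matrix.mul_assoc, hV', Matrix.one_mul]
  have hSV : S * V = V * diagonal lam := by
    rw [hS, Matrix.mul_assoc, hV, Matrix.mul_one]
  -- Above the cut-off, truncation loses nothing: column j of U combines only eigenvectors of S with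
  -- eigenvalue exactly `lam j`.
  have hSU : ∀ (i j : Fin d), (j : ℕ) < κ → c < lam j → (S * U) i j = U i j * lam j := by
    intro i j hj hcj
    have hlj : c + l j = lam j := by rw [hev j hj, max_eq_left hcj.le]
    have h1 : S * U = V * (diagonal lam * (Vᵀ * U)) := by
      conv_lhs => rw [hUV]
      rw [← Matrix.mul_assoc, hSV, Matrix.mul_assoc]
    have h2 : U i j = ∑ k, V i k * (Vᵀ * U) k j := by
      conv_lhs => rw [hUV]
      rw [mul_apply]
    rw [h1, mul_apply, h2, Finset.sum_mul]
    refine Finset.sum_congr rfl fun k _ => ?_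
    rw [diagonal_mul]
    by_cases hk : (Vᵀ * U) k j = 0
    · simp [hk]
    · have := hort k j hj hk
      rw [hlj] at this
      have : lam k = lam j := by
        rcases le_total (lam k) c with h | h
        · rw [max_eq_right h] at this; linarith
        · rw [max_eq_left h] at this; exact this.symm
      rw [this]; ring
  have hcross : ∀ i j : Fin d, (j : ℕ) < κ → c < lam j → lam i ≤ c → (Vᵀ * U) i j = 0 := by
    intro i j hj hcj hi
    by_contra hne
    have := hort i j hj hne
    rw [hev j hj, max_eq_left hcj.le, max_eq_right hi] at this
    linarith
  -- Columns of U above the cut-off are eigenvectors of S by `hSU`. The other columns of U need not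
  -- be, but they carry weight zero in WWᵀ and may be replaced by those of V; `hcross` keeps the
  -- mixture orthonormal.
  set X : Matrix (Fin d) (Fin κ) ℝ := of fun i j =>
    if c < lam (Fin.castLE hκ j) then U i (Fin.castLE hκ j) else V i (Fin.castLE hκ j) with hX
  refine ⟨X, ⟨?_, ?_⟩, ?_⟩
  · ext i j
    have hone : ∀ A : Matrix (Fin d) (Fin d) ℝ, A = 1 →
        A (Fin.castLE hκ i) (Fin.castLE hκ j) = (1 : Matrix (Fin κ) (Fin κ) ℝ) i j := by
      rintro _ rfl
      simp [one_apply]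
    by_cases hi : c < lam (Fin.castLE hκ i) <;> by_cases hj : c < lam (Fin.castLE hκ j)
    · rw [← hone _ hU]; simp [mul_apply, hX, hi, hj]
    · have h1 := hcross (Fin.castLE hκ j) (Fin.castLE hκ i) i.2 hi (not_lt.1 hj)
      have hij : i ≠ j := fun h => hj (h ▸ hi)
      rw [one_apply_ne hij, ← h1]
      simp [mul_apply, hX, hi, hj, mul_comm]
    · have h1 := hcross (Fin.castLE hκ i) (Fin.castLE hκ j) j.2 hj (not_lt.1 hi)
      have hij : i ≠ j := fun h => hi (h ▸ hj)
      rw [one_apply_ne hij, ← h1]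
      simp [mul_apply, hX, hi, hj]
    · rw [← hone _ hV]; simp [mul_apply, hX, hi, hj]
  · ext i j
    rw [mul_diagonal]
    by_cases hj : c < lam (Fin.castLE hκ j)
    · have := hSU i (Fin.castLE hκ j) j.2 hj
      simpa [mul_apply, hX, hj] using this
    · have := congrFun (congrFun hSV i) (Fin.castLE hκ j)
      rw [mul_diagonal] at this
      simpa [mul_apply, hX, hj] using this
  · rw [hW]
    ext i k
    obtain ⟨e, rfl⟩ := Nat.exists_eq_add_of_le hκ
    rw [mul_apply, mul_apply, Fin.sum_univ_add]
    have hz : ∑ j : Fin e, (U * diagonal l) i (Fin.natAdd κ j) * Uᵀ (Fin.natAdd κ j) k = 0 :=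
      Finset.sum_eq_zero fun j _ => by
        rw [mul_diagonal, hl0 _ (by simp)]; ring
    rw [hz, add_zero]
    refine Finset.sum_congr rfl fun j _ => ?_
    have hlj : l (Fin.castAdd e j) = max (lam (Fin.castLE hκ j)) c - c := by
      have := hev (Fin.castAdd e j) (by simp)
      rw [eq_sub_iff_add_eq, add_comm]
      exact this
    rw [mul_diagonal, mul_diagonal, hlj]
    by_cases hj : c < lam (Fin.castLE hκ j)
    · simp only [hX, transpose_apply, of_apply, if_pos hj]
      rfl
    · rw [max_eq_right (not_lt.1 hj)]; ring

/-- The value of the loss at the matrices given by leading eigenvectors of `S`. -/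
theorem ppcaLoss_eq_ppcaMin (hc : 0 < c) (hκ : κ ≤ d) (hV : Vᵀ * V = 1)
    (hS : S = V * diagonal lam * Vᵀ) {X : Matrix (Fin d) (Fin κ) ℝ}
    (hX : IsEigenframe S (fun j => lam (Fin.castLE hκ j)) X)
    (hW : W * Wᵀ = X * diagonal (fun j => max (lam (Fin.castLE hκ j)) c - c) * Xᵀ) :
    ppcaLoss c S W = ppcaMin κ c lam := by
  set k : Fin κ → ℝ := fun j => max (lam (Fin.castLE hκ j)) c with hk
  have hkc : ∀ j, c ≤ k j := fun j => le_max_right _ _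
  have hk0 : ∀ j, 0 < k j := fun j => hc.trans_le (hkc j)
  set L : Matrix (Fin κ) (Fin κ) ℝ := diagonal fun j => Real.sqrt (k j - c) with hL
  have hLL : L * L = diagonal fun j => k j - c := by
    rw [hL, diagonal_mul_diagonal]
    congr 1
    ext j
    exact Real.mul_self_sqrt (sub_nonneg.2 (hkc j))
  have hLT : Lᵀ = L := diagonal_transpose _
  -- The loss depends on W only through WWᵀ = YYᵀ. For Y the κ×κ matrix cI + YᵀY is diagonal, so
  -- Woodbury and Sylvester give explicit values.
  set Y := X * L with hY
  have hYY : Y * Yᵀ = W * Wᵀ := by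
    rw [hW, ← hLL, hY, transpose_mul, hLT]
    simp only [Matrix.mul_assoc]
  have hYTY : c • (1 : Matrix (Fin κ) (Fin κ) ℝ) + Yᵀ * Y = diagonal k := by
    rw [hY, transpose_mul, hLT, Matrix.mul_assoc, ← Matrix.mul_assoc Xᵀ, hX.1, Matrix.one_mul, hLL,
      smul_one_eq_diagonal, diagonal_add]
    congr 1; ext j; ring
  have hinvk : (diagonal k)⁻¹ = diagonal fun j => (k j)⁻¹ := by
    refine inv_eq_right_inv ?_
    rw [diagonal_mul_diagonal]
    simp [mul_inv_cancel₀ (hk0 _).ne']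
  have htr : S.trace = ∑ j, lam j := by
    rw [hS, trace_mul_comm, ← Matrix.mul_assoc, hV, Matrix.one_mul, trace_diagonal]
  have hXSX : Xᵀ * S * X = diagonal fun j => lam (Fin.castLE hκ j) := by
    rw [Matrix.mul_assoc, hX.2, ← Matrix.mul_assoc, hX.1, Matrix.one_mul]
  have h1 : ((c • (1 : Matrix (Fin d) (Fin d) ℝ) + W * Wᵀ)⁻¹ * S).trace
      = c⁻¹ * (∑ j, lam j - ∑ j, (k j - c) / k j * lam (Fin.castLE hκ j)) := by
    rw [← hYY, inv_smul_one_add_mul_transpose_self Y hc, hYTY, hinvk, Matrix.smul_mul, trace_smul,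
      Matrix.sub_mul, Matrix.one_mul, trace_sub, htr, smul_eq_mul]
    congr 2
    have : Y * (diagonal fun j => (k j)⁻¹) * Yᵀ * S
        = X * ((L * (diagonal fun j => (k j)⁻¹) * L) * (Xᵀ * S)) := by
      rw [hY, transpose_mul, hLT]
      simp only [Matrix.mul_assoc]
    rw [this, trace_mul_comm, Matrix.mul_assoc, hXSX, hL, diagonal_mul_diagonal,
      diagonal_mul_diagonal, diagonal_mul_diagonal, trace_diagonal]
    refine Finset.sum_congr rfl fun j _ => ?_
    have := Real.mul_self_sqrt (sub_nonneg.2 (hkc j))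
    rw [div_eq_mul_inv]
    linear_combination (k j)⁻¹ * lam (Fin.castLE hκ j) * this
  have h2 : Real.log (c • (1 : Matrix (Fin d) (Fin d) ℝ) + W * Wᵀ).det
      = d * Real.log c + ∑ j, (Real.log (k j) - Real.log c) := by
    have hdet : (c⁻¹ • diagonal k).det = ∏ j, (k j / c) := by
      rw [← diagonal_smul, det_diagonal]
      refine Finset.prod_congr rfl fun j _ => ?_
      simp [div_eq_inv_mul]
    rw [← hYY, det_smul_one_add_mul_transpose_self Y hc, hYTY, hdet,
      Real.log_mul (by positivity) (Finset.prod_ne_zero_iff.2 fun j _ =>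
        (div_pos (hk0 j) hc).ne'), Real.log_pow,
      Real.log_prod fun j _ => (div_pos (hk0 j) hc).ne']
    congr 1
    exact Finset.sum_congr rfl fun j _ => Real.log_div (hk0 j).ne' hc.ne'
  rw [ppcaLoss, h1, h2, ppcaMin]
  obtain ⟨e, rfl⟩ := Nat.exists_eq_add_of_le hκ
  have hd : (((κ + e : ℕ) : ℝ)) * Real.log c
      = ∑ _j : Fin κ, Real.log c + ∑ _j : Fin e, Real.log c := by
    simp; ring
  rw [hd, Fin.sum_univ_add, Fin.sum_univ_add]
  simp only [Fin.val_castAdd, Fin.is_lt, if_true, Fin.val_natAdd, add_lt_iff_neg_left, not_lt_zero,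
    if_false]
  rw [mul_sub, mul_add, Finset.mul_sum, Finset.mul_sum, Finset.mul_sum, Finset.sum_add_distrib,
    Finset.sum_add_distrib, Finset.sum_sub_distrib]
  have hcomb : ∀ j : Fin κ, c⁻¹ * ((k j - c) / k j * lam (Fin.castLE hκ j))
      = c⁻¹ * lam (Fin.castAdd e j) - lam (Fin.castAdd e j) / k j := by
    intro j
    have := (hk0 j).ne'
    change c⁻¹ * ((k j - c) / k j * lam (Fin.castAdd e j)) = _
    field_simp
  rw [Finset.sum_congr rfl fun j _ => hcomb j, Finset.sum_sub_distrib]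
  have h3 : ∀ j : Fin e, lam (Fin.natAdd κ j) / c = c⁻¹ * lam (Fin.natAdd κ j) :=
    fun j => div_eq_inv_mul _ _
  simp only [h3]
  have h4 : ∀ j, k j = max (lam (Fin.castAdd e j)) c := fun j => rfl
  simp only [h4]
  ring

end PPCA

/-! ### Recovering a matrix from its Gram matrix -/

section OrthogonalFactor

variable {d κ : ℕ}

/-- Two matrices with the same Gram matrix of rows differ by an orthogonal factor. -/
theorem exists_orthogonal_of_mul_transpose_eq {A B : Matrix (Fin d) (Fin κ) ℝ}
    (h : A * Aᵀ = B * Bᵀ) : ∃ R : Matrix (Fin κ) (Fin κ) ℝ, Rᵀ * R = 1 ∧ A = B * R := by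
  let TA := toEuclideanLin Aᵀ
  let TB := toEuclideanLin Bᵀ
  -- Both squared norms are the quadratic form of AAᵀ = BBᵀ. Hence `TB v ↦ TA v` is a well-defined
  -- isometry on the range of `TB`, and it extends to the whole space.
  have hnorm : ∀ v, ‖TA v‖ = ‖TB v‖ := by
    have hsq : ∀ (M : Matrix (Fin d) (Fin κ) ℝ) (v : EuclideanSpace ℝ (Fin d)),
        ‖toEuclideanLin Mᵀ v‖ ^ 2 = v.ofLp ⬝ᵥ (M * Mᵀ) *ᵥ v.ofLp := by
      intro M v
      rw [← mulVec_mulVec, dotProduct_mulVec, ← mulVec_transpose, EuclideanSpace.real_norm_sq_eq]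
      simp [dotProduct, pow_two, toLpLin_apply]
    intro v
    rw [← sq_eq_sq₀ (norm_nonneg _) (norm_nonneg _), hsq, hsq, h]
  obtain ⟨g, hg⟩ := LinearMap.exists_rightInverse_of_surjective TB.rangeRestrict
    TB.range_rangeRestrict
  have hg' : ∀ s, TB (g s) = s := fun s => congrArg Subtype.val (LinearMap.congr_fun hg s)
  let L : LinearMap.range TB →ₗᵢ[ℝ] EuclideanSpace ℝ (Fin κ) :=
    ⟨TA ∘ₗ g, fun s => by
      rw [LinearMap.comp_apply, hnorm, hg']; rfl⟩
  have hL : ∀ v, L.extend (TB v) = TA v := by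
    intro v
    have h1 : L.extend (TB v) = TA (g (TB.rangeRestrict v)) :=
      L.extend_apply (TB.rangeRestrict v)
    -- Independence of the section `g`: by `hnorm`, `TA` vanishes on the kernel of `TB`.
    rw [h1, ← sub_eq_zero, ← map_sub, ← norm_eq_zero, hnorm, map_sub, hg']
    simp
  let O : EuclideanSpace ℝ (Fin κ) →ₗ[ℝ] EuclideanSpace ℝ (Fin κ) := L.extend.toLinearMap
  let Q : Matrix (Fin κ) (Fin κ) ℝ := toEuclideanLin.symm O
  have hQ : ∀ w, (L.extend w).ofLp = Q *ᵥ w.ofLp := by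
    intro w
    have : toEuclideanLin Q = O := LinearEquiv.apply_symm_apply _ _
    have h2 : O w = WithLp.toLp 2 (Q *ᵥ w.ofLp) := by rw [← this]; rfl
    exact congrArg WithLp.ofLp h2
  have hQA : Aᵀ = Q * Bᵀ := by
    refine ext_of_mulVec_single fun j => ?_
    rw [← mulVec_mulVec]
    have := congrArg WithLp.ofLp (hL (WithLp.toLp 2 (Pi.single j 1)))
    rw [hQ] at this
    exact this.symm
  have hQQ : Qᵀ * Q = 1 := by
    ext i j
    have h1 := L.extend.inner_map_map (WithLp.toLp 2 (Pi.single i (1 : ℝ)))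
      (WithLp.toLp 2 (Pi.single j (1 : ℝ)))
    rw [EuclideanSpace.inner_eq_star_dotProduct, EuclideanSpace.inner_eq_star_dotProduct, hQ, hQ]
      at h1
    simp only [star_trivial, mulVec_single_one, dotProduct_single_one] at h1
    rw [mul_apply]
    simp only [dotProduct, col_apply] at h1
    simp only [transpose_apply, mul_comm (Q _ i), h1, one_apply, Pi.single_apply]
  refine ⟨Qᵀ, ?_, ?_⟩
  · rw [transpose_transpose]; exact mul_eq_one_comm.1 hQQ
  · rw [← transpose_transpose A, hQA, transpose_mul, transpose_transpose]

theorem det_mul_self_eq_one {R : Matrix (Fin κ) (Fin κ) ℝ} (hR : Rᵀ * R = 1) :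
    R.det = 1 ∨ R.det = -1 := by
  have := congrArg det hR
  rw [det_mul, det_transpose, det_one] at this
  exact mul_self_eq_one_iff.1 this

end OrthogonalFactor

/-! ### Maximizers of the approximate objective -/

section Objective

variable (E : EDF) {β : ℝ} {d κ N : ℕ} (x : Fin N → Fin d → ℝ)

/-- Bias-variance decomposition: the cross terms cancel because `bHat` is the mean of the
observations. -/
theorem matS_eq (hN : 0 < N) (b : Fin d → ℝ) :
    matS E x b = sampleCov E x + vecMulVec (bHat E x - b) (bHat E x - b) := by
  have hN' : (N : ℝ) ≠ 0 := by positivity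
  ext k l
  have hb : ∀ k, ∑ i, obs E x i k = N * bHat E x k := by
    intro k
    simp [bHat, Finset.sum_apply, hN']
  have hexp : ∀ b : Fin d → ℝ, matS E x b k l = (N : ℝ)⁻¹ * ∑ i, obs E x i k * obs E x i l
      - bHat E x k * b l - b k * bHat E x l + b k * b l := by
    intro b
    have h1 : matS E x b k l = (N : ℝ)⁻¹ * ∑ i, (obs E x i k - b k) * (obs E x i l - b l) := by
      simp [matS, Matrix.sum_apply, vecMulVec_apply]
    have h2 : ∀ i, (obs E x i k - b k) * (obs E x i l - b l)
        = obs E x i k * obs E x i l - obs E x i k * b l - b k * obs E x i l + b k * b l := by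
      intro i; ring
    simp only [h1, h2, Finset.sum_add_distrib, Finset.sum_sub_distrib, ← Finset.sum_mul,
      ← Finset.mul_sum, hb, Finset.sum_const, Finset.card_univ, Fintype.card_fin, nsmul_eq_mul]
    field_simp
  rw [Matrix.add_apply, sampleCov, hexp, hexp, vecMulVec_apply, Pi.sub_apply, Pi.sub_apply]
  ring

/-- The approximate objective in terms of the loss of probabilistic principal component
analysis. -/
theorem approxObjective_eq (hF2 : 0 < E.F2) (hβ : 0 < β) (hN : 0 < N)
    (W : Matrix (Fin d) (Fin κ) ℝ) (b : Fin d → ℝ) :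
    approxObjective E β x W b = -(1 / 2) * (β * (ppcaLoss (cutOff E β) (sampleCov E x) W
      + (bHat E x - b) ⬝ᵥ (cutOff E β • (1 : Matrix (Fin d) (Fin d) ℝ) + W * Wᵀ)⁻¹ *ᵥ
          (bHat E x - b))
      + (β * d * Real.log (E.φ⁻¹ * E.F2) - β * d * Real.log β + constD E x)) := by
  rw [approxObjective, matS_eq E x hN, log_det_matC E hF2 hβ, inv_matC E hF2 hβ, Matrix.mul_add,
    trace_add, Matrix.smul_mul, Matrix.smul_mul, trace_smul, trace_smul, mul_vecMulVec,
    trace_vecMulVec, dotProduct_comm, ppcaLoss, smul_eq_mul, smul_eq_mul]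
  ring

theorem posDef_inv_smul_one_add (hF2 : 0 < E.F2) (hβ : 0 < β) (W : Matrix (Fin d) (Fin κ) ℝ) :
    (cutOff E β • (1 : Matrix (Fin d) (Fin d) ℝ) + W * Wᵀ)⁻¹.PosDef :=
  (posDef_smul_one_add_mul_transpose_self W (cutOff_pos E hF2 hβ)).inv

variable {E x}

theorem isTopEigenvectors_iff {hκ : κ ≤ d} {U : Matrix (Fin d) (Fin κ) ℝ} :
    IsTopEigenvectors E x hκ U ↔
      IsEigenframe (sampleCov E x) (fun j => eig E x (Fin.castLE hκ j)) U := by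
  refine and_congr_right fun _ => ⟨fun h => ?_, fun h j => ?_⟩
  · ext i j
    have := congrFun (h j) i
    rw [mul_diagonal, mul_comm]
    exact this
  · ext i
    have := congrFun (congrFun h i) j
    rw [mul_diagonal, mul_comm] at this
    exact this

theorem kEntry_eq_max (hκ : κ ≤ d) (j : Fin κ) :
    kEntry E β x hκ j = max (eig E x (Fin.castLE hκ j)) (cutOff E β) := by
  rw [kEntry, max_comm, max_def]

theorem antitone_eig : Antitone (eig E x) :=
  antitone_eigenvalues₀_cast (isHermitian_sampleCov E x)

theorem exists_diagonalization_sampleCov :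
    ∃ V : Matrix (Fin d) (Fin d) ℝ, Vᵀ * V = 1 ∧ V * Vᵀ = 1 ∧
      sampleCov E x = V * diagonal (eig E x) * Vᵀ :=
  exists_orthogonal_diagonalization (isHermitian_sampleCov E x)

theorem exists_isTopEigenvectors (hκ : κ ≤ d) :
    ∃ U : Matrix (Fin d) (Fin κ) ℝ, IsTopEigenvectors E x hκ U := by
  obtain ⟨V, hV, -, hS⟩ := exists_diagonalization_sampleCov (E := E) (x := x)
  exact ⟨_, isTopEigenvectors_iff.2 (isEigenframe_submatrix hκ hV hS)⟩

theorem transpose_matL (hκ : κ ≤ d) : (matL E β x hκ)ᵀ = matL E β x hκ :=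
  diagonal_transpose _

theorem matL_mul_self (hκ : κ ≤ d) : matL E β x hκ * matL E β x hκ
    = diagonal fun j => max (eig E x (Fin.castLE hκ j)) (cutOff E β) - cutOff E β := by
  rw [matL, diagonal_mul_diagonal]
  congr 1
  ext j
  rw [kEntry_eq_max]
  exact Real.mul_self_sqrt (sub_nonneg.2 (le_max_right _ _))

theorem wHat_mul_transpose (hκ : κ ≤ d) (U : Matrix (Fin d) (Fin κ) ℝ)
    {R : Matrix (Fin κ) (Fin κ) ℝ} (hR : R * Rᵀ = 1) :
    wHat E β x hκ U R * (wHat E β x hκ U R)ᵀ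
      = U * (diagonal fun j => max (eig E x (Fin.castLE hκ j)) (cutOff E β) - cutOff E β) * Uᵀ := by
  rw [← matL_mul_self, wHat, transpose_mul, transpose_mul, transpose_matL, Matrix.mul_assoc,
    ← Matrix.mul_assoc R, hR, Matrix.one_mul]
  simp only [Matrix.mul_assoc]

theorem ppcaLoss_wHat (hF2 : 0 < E.F2) (hβ : 0 < β) (hκ : κ ≤ d)
    {U : Matrix (Fin d) (Fin κ) ℝ} (hU : IsTopEigenvectors E x hκ U)
    {R : Matrix (Fin κ) (Fin κ) ℝ} (hR : R * Rᵀ = 1) :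
    ppcaLoss (cutOff E β) (sampleCov E x) (wHat E β x hκ U R)
      = ppcaMin κ (cutOff E β) (eig E x) := by
  obtain ⟨V, hV, -, hS⟩ := exists_diagonalization_sampleCov (E := E) (x := x)
  exact ppcaLoss_eq_ppcaMin (cutOff_pos E hF2 hβ) hκ hV hS (isTopEigenvectors_iff.1 hU)
    (wHat_mul_transpose hκ U hR)

theorem approxObjective_le_wHat (hF2 : 0 < E.F2) (hβ : 0 < β) (hN : 0 < N) (hκ : κ ≤ d)
    {U : Matrix (Fin d) (Fin κ) ℝ} (hU : IsTopEigenvectors E x hκ U)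
    {R : Matrix (Fin κ) (Fin κ) ℝ} (hR : R * Rᵀ = 1) (W : Matrix (Fin d) (Fin κ) ℝ)
    (b : Fin d → ℝ) :
    approxObjective E β x W b ≤ approxObjective E β x (wHat E β x hκ U R) (bHat E x) := by
  obtain ⟨V, hV, hV', hS⟩ := exists_diagonalization_sampleCov (E := E) (x := x)
  rw [approxObjective_eq E x hF2 hβ hN, approxObjective_eq E x hF2 hβ hN,
    ppcaLoss_wHat hF2 hβ hκ hU hR, sub_self, zero_dotProduct, add_zero]
  have h1 := ppcaMin_le_ppcaLoss (cutOff_pos E hF2 hβ) antitone_eig hV' hS W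
  have h2 := (posDef_inv_smul_one_add E hF2 hβ W).quadraticForm_nonneg (bHat E x - b)
  have h3 := mul_le_mul_of_nonneg_left (add_le_add h1 h2) hβ.le
  rw [add_zero] at h3
  linarith

/-- Diagonal sign matrices commute with L, so signs can be moved between the eigenvectors and R;
this is used to correct the determinant of R. -/
theorem mul_diagonal_sign_wHat (hκ : κ ≤ d) (U : Matrix (Fin d) (Fin κ) ℝ)
    (R : Matrix (Fin κ) (Fin κ) ℝ) {s : Fin κ → ℝ} (hs : ∀ j, s j * s j = 1) :
    wHat E β x hκ (U * diagonal s) (diagonal s * R) = wHat E β x hκ U R := by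
  have h : diagonal s * matL E β x hκ * diagonal s = matL E β x hκ := by
    rw [matL, diagonal_mul_diagonal, diagonal_mul_diagonal]
    congr 1
    ext j
    rw [mul_right_comm, hs, one_mul]
  calc _ = U * (diagonal s * matL E β x hκ * diagonal s) * R := by
        simp only [wHat, Matrix.mul_assoc]
    _ = _ := by rw [h, wHat]

theorem IsEigenframe.mul_diagonal_sign {S : Matrix (Fin d) (Fin d) ℝ} {lam : Fin κ → ℝ}
    {U : Matrix (Fin d) (Fin κ) ℝ} (hU : IsEigenframe S lam U) {s : Fin κ → ℝ}
    (hs : ∀ j, s j * s j = 1) : IsEigenframe S lam (U * diagonal s) := by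
  constructor
  · rw [transpose_mul, Matrix.mul_assoc, ← Matrix.mul_assoc Uᵀ, hU.1, Matrix.one_mul,
      diagonal_transpose, diagonal_mul_diagonal]
    simp [hs]
  · rw [← Matrix.mul_assoc, hU.2, Matrix.mul_assoc, Matrix.mul_assoc, diagonal_mul_diagonal,
      diagonal_mul_diagonal]
    simp only [mul_comm]

/-- Comparison with one known maximizer bounds loss plus mean-shift penalty by `ppcaMin`. Since the
loss is at least `ppcaMin` and the penalty is nonnegative, the penalty vanishes and W minimizes the
loss. -/
theorem eq_wHat_of_isMax (hF2 : 0 < E.F2) (hβ : 0 < β) (hN : 0 < N) (hκ : κ ≤ d)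
    {W : Matrix (Fin d) (Fin κ) ℝ} {b : Fin d → ℝ}
    (hmax : ∀ (W' : Matrix (Fin d) (Fin κ) ℝ) (b' : Fin d → ℝ),
      approxObjective E β x W' b' ≤ approxObjective E β x W b) :
    b = bHat E x ∧ ∃ U : Matrix (Fin d) (Fin κ) ℝ, IsTopEigenvectors E x hκ U ∧
      ∃ R ∈ Matrix.specialOrthogonalGroup (Fin κ) ℝ, W = wHat E β x hκ U R := by
  obtain ⟨V, hV, hV', hS⟩ := exists_diagonalization_sampleCov (E := E) (x := x)
  have hc := cutOff_pos E hF2 hβ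
  obtain ⟨U₀, hU₀⟩ := exists_isTopEigenvectors (E := E) (x := x) hκ
  have hRone : (1 : Matrix (Fin κ) (Fin κ) ℝ) * (1 : Matrix (Fin κ) (Fin κ) ℝ)ᵀ = 1 := by simp
  have h0 := hmax (wHat E β x hκ U₀ 1) (bHat E x)
  rw [approxObjective_eq E x hF2 hβ hN, approxObjective_eq E x hF2 hβ hN,
    ppcaLoss_wHat hF2 hβ hκ hU₀ hRone, sub_self, zero_dotProduct, add_zero] at h0
  have h1 := ppcaMin_le_ppcaLoss hc antitone_eig hV' hS W
  have hP := posDef_inv_smul_one_add E hF2 hβ W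
  have h2 := hP.quadraticForm_nonneg (bHat E x - b)
  have h3 : ppcaLoss (cutOff E β) (sampleCov E x) W + (bHat E x - b) ⬝ᵥ
      (cutOff E β • (1 : Matrix (Fin d) (Fin d) ℝ) + W * Wᵀ)⁻¹ *ᵥ (bHat E x - b)
      ≤ ppcaMin κ (cutOff E β) (eig E x) :=
    le_of_mul_le_mul_left (by linarith) hβ
  refine ⟨?_, ?_⟩
  · have := hP.quadraticForm_eq_zero_iff.1 (le_antisymm (by linarith) h2)
    exact (sub_eq_zero.1 this).symm
  · obtain ⟨X, hX, hWX⟩ := exists_isEigenframe_of_ppcaLoss_le hc antitone_eig hκ hV hV' hS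
      (by linarith : ppcaLoss (cutOff E β) (sampleCov E x) W ≤ ppcaMin κ (cutOff E β) (eig E x))
    obtain ⟨R, hR, hWR⟩ := exists_orthogonal_of_mul_transpose_eq
      (hWX.trans (wHat_mul_transpose (β := β) hκ X hRone).symm)
    have hWR' : W = wHat E β x hκ X R := by
      rw [hWR]; simp only [wHat, Matrix.mul_one]
    have hmem : ∀ {R : Matrix (Fin κ) (Fin κ) ℝ}, Rᵀ * R = 1 → R.det = 1 →
        R ∈ Matrix.specialOrthogonalGroup (Fin κ) ℝ := fun h h' =>
      mem_specialOrthogonalGroup_iff.2 ⟨(mem_orthogonalGroup_iff' _ _).2 h, h'⟩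
    rcases det_mul_self_eq_one hR with hdet | hdet
    · exact ⟨X, isTopEigenvectors_iff.2 hX, R, hmem hR hdet, hWR'⟩
    -- For κ = 0 the determinant is 1, so this case is void; otherwise the first column of X and the
    -- first row of R change sign.
    · rcases Nat.eq_zero_or_pos κ with rfl | hκ0
      · rw [det_isEmpty] at hdet
        norm_num at hdet
      · let s : Fin κ → ℝ := Function.update 1 ⟨0, hκ0⟩ (-1)
        have hs : ∀ j, s j * s j = 1 := by
          intro j
          by_cases hj : j = ⟨0, hκ0⟩ <;> simp [s, hj]
        refine ⟨X * diagonal s, isTopEigenvectors_iff.2 (hX.mul_diagonal_sign hs),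
          diagonal s * R, hmem ?_ ?_, ?_⟩
        · rw [transpose_mul, diagonal_transpose, Matrix.mul_assoc, ← Matrix.mul_assoc (diagonal s),
            diagonal_mul_diagonal]
          simp [hs, hR]
        · rw [det_mul, det_diagonal, hdet, Finset.prod_update_of_mem (Finset.mem_univ _)]
          simp
        · rw [mul_diagonal_sign_wHat hκ X R hs, hWR']

end Objective

/-! ### Closed forms at the maximizers, pruning and collapse -/

section Consequences

variable {E : EDF} {β : ℝ} {d κ N : ℕ} {x : Fin N → Fin d → ℝ}

theorem kEntry_pos (hF2 : 0 < E.F2) (hβ : 0 < β) (hκ : κ ≤ d) (j : Fin κ) :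
    0 < kEntry E β x hκ j := by
  rw [kEntry_eq_max]
  exact lt_max_of_lt_right (cutOff_pos E hF2 hβ)

theorem posDef_matK (hF2 : 0 < E.F2) (hβ : 0 < β) (hκ : κ ≤ d) : (matK E β x hκ).PosDef :=
  PosDef.diagonal fun j => kEntry_pos hF2 hβ hκ j

/-- WᵀW = RᵀL²R because U has orthonormal columns, and K = cI + L². -/
theorem scaledPrecision_wHat (hκ : κ ≤ d) {U : Matrix (Fin d) (Fin κ) ℝ} (hU : Uᵀ * U = 1)
    {R : Matrix (Fin κ) (Fin κ) ℝ} (hR : Rᵀ * R = 1) :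
    scaledPrecision E β (wHat E β x hκ U R) = Rᵀ * matK E β x hκ * R := by
  have hK : matK E β x hκ = cutOff E β • (1 : Matrix (Fin κ) (Fin κ) ℝ)
      + matL E β x hκ * matL E β x hκ := by
    rw [matL_mul_self, smul_one_eq_diagonal, diagonal_add, matK]
    congr 1
    ext j
    rw [kEntry_eq_max]
    ring
  have hW : (wHat E β x hκ U R)ᵀ * wHat E β x hκ U R
      = Rᵀ * (matL E β x hκ * matL E β x hκ) * R := by
    rw [wHat, transpose_mul, transpose_mul, transpose_matL]
    calc _ = Rᵀ * (matL E β x hκ * (Uᵀ * U) * matL E β x hκ) * R := by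
          simp only [Matrix.mul_assoc]
      _ = _ := by rw [hU, Matrix.mul_one]
  rw [scaledPrecision, hW, hK, Matrix.mul_add, Matrix.add_mul, Matrix.mul_smul, Matrix.smul_mul,
    Matrix.mul_one, hR]

theorem inv_transpose_mul_mul {K R : Matrix (Fin κ) (Fin κ) ℝ} (hK : K.PosDef)
    (hR : Rᵀ * R = 1) : (Rᵀ * K * R)⁻¹ = Rᵀ * K⁻¹ * R := by
  refine inv_eq_right_inv ?_
  calc _ = Rᵀ * (K * (R * Rᵀ) * K⁻¹) * R := by simp only [Matrix.mul_assoc]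
    _ = 1 := by
      rw [mul_eq_one_comm.1 hR, Matrix.mul_one,
        mul_nonsing_inv _ (isUnit_iff_ne_zero.2 hK.det_pos.ne'), Matrix.mul_one, hR]

theorem sigmaHat_eq (hF2 : 0 < E.F2) (hβ : 0 < β) (hκ : κ ≤ d) {U : Matrix (Fin d) (Fin κ) ℝ}
    (hU : Uᵀ * U = 1) {R : Matrix (Fin κ) (Fin κ) ℝ} (hR : Rᵀ * R = 1) :
    ((cutOff E β)⁻¹ • scaledPrecision E β (wHat E β x hκ U R))⁻¹ = sigmaHat E β x hκ R := by
  have hc := (cutOff_pos E hF2 hβ).ne'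
  have hP := posDef_scaledPrecision E hF2 hβ (wHat E β x hκ U R)
  have h1 : ((cutOff E β)⁻¹ • scaledPrecision E β (wHat E β x hκ U R))⁻¹
      = cutOff E β • (scaledPrecision E β (wHat E β x hκ U R))⁻¹ := by
    refine inv_eq_right_inv ?_
    rw [smul_mul_smul_comm, inv_mul_cancel₀ hc,
      mul_nonsing_inv _ (isUnit_iff_ne_zero.2 hP.det_pos.ne'), one_smul]
  rw [h1, scaledPrecision_wHat hκ hU hR, inv_transpose_mul_mul (posDef_matK hF2 hβ hκ) hR,
    sigmaHat, cutOff]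
  congr 1
  rw [div_eq_mul_inv]
  ring

theorem obs_sub_bHat (hN : 0 < N) (i : Fin N) :
    obs E x i - bHat E x = (1 / E.F2) • (x i - xBar x) := by
  have hN' : (N : ℝ) ≠ 0 := by positivity
  ext j
  simp only [Pi.sub_apply, Pi.smul_apply, smul_eq_mul, bHat, xBar, obs, Finset.sum_apply,
    ← Finset.mul_sum, Finset.sum_sub_distrib, Finset.sum_const, Finset.card_univ,
    Fintype.card_fin, nsmul_eq_mul]
  field_simp
  ring

theorem muHat_eq (hF2 : 0 < E.F2) (hβ : 0 < β) (hN : 0 < N) (hκ : κ ≤ d)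
    {U : Matrix (Fin d) (Fin κ) ℝ} (hU : Uᵀ * U = 1) {R : Matrix (Fin κ) (Fin κ) ℝ}
    (hR : Rᵀ * R = 1) (i : Fin N) :
    WithLp.toLp 2 (optMean E β x (wHat E β x hκ U R) (bHat E x) i) = muHat E β x hκ U R i := by
  rw [muHat, optMean, scaledPrecision_wHat hκ hU hR,
    inv_transpose_mul_mul (posDef_matK hF2 hβ hκ) hR, obs_sub_bHat hN, mulVec_mulVec, wHat,
    transpose_mul, transpose_mul, transpose_matL]
  congr 2
  calc _ = Rᵀ * (matK E β x hκ)⁻¹ * (R * Rᵀ) * matL E β x hκ * Uᵀ := by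
        simp only [Matrix.mul_assoc]
    _ = _ := by rw [mul_eq_one_comm.1 hR, Matrix.mul_one]

theorem muHat_eq_smul (hF2 : 0 < E.F2) (hβ : 0 < β) (hκ : κ ≤ d)
    (U : Matrix (Fin d) (Fin κ) ℝ) {R : Matrix (Fin κ) (Fin κ) ℝ} (hR : Rᵀ * R = 1) (i : Fin N) :
    muHat E β x hκ U R i = WithLp.toLp 2 ((1 / (β * E.φ)) •
      ((sigmaHat E β x hκ R * (wHat E β x hκ U R)ᵀ) *ᵥ (x i - xBar x))) := by
  have hφ := E.φ_pos
  have h1 : sigmaHat E β x hκ R * (wHat E β x hκ U R)ᵀ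
      = (β * E.φ / E.F2) • (Rᵀ * (matK E β x hκ)⁻¹ * matL E β x hκ * Uᵀ) := by
    rw [sigmaHat, wHat, transpose_mul, transpose_mul, transpose_matL, Matrix.smul_mul]
    congr 1
    calc _ = Rᵀ * (matK E β x hκ)⁻¹ * (R * Rᵀ) * matL E β x hκ * Uᵀ := by
          simp only [Matrix.mul_assoc]
      _ = _ := by rw [mul_eq_one_comm.1 hR, Matrix.mul_one]
  rw [h1, smul_mulVec, smul_smul, muHat, mulVec_smul]
  congr 2
  field_simp

theorem posDef_sigmaHat (hF2 : 0 < E.F2) (hβ : 0 < β) (hκ : κ ≤ d)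
    {R : Matrix (Fin κ) (Fin κ) ℝ} (hR : Rᵀ * R = 1) : (sigmaHat E β x hκ R).PosDef := by
  have hφ := E.φ_pos
  have hdet : IsUnit (Rᵀ).det := by
    refine IsUnit.of_mul_eq_one R.det ?_
    rw [← det_mul, hR, det_one]
  have h := posDef_mul_mul_transpose_same (posDef_matK (x := x) hF2 hβ hκ).inv hdet
  rw [transpose_transpose] at h
  exact h.smul (by positivity)

theorem matL_entry_eq_zero_iff (hκ : κ ≤ d) (j : Fin κ) :
    Real.sqrt (kEntry E β x hκ j - cutOff E β) = 0 ↔ eig E x (Fin.castLE hκ j) ≤ cutOff E β := by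
  rw [Real.sqrt_eq_zero', sub_nonpos, kEntry_eq_max, max_le_iff]
  simp

theorem wHat_mul_transpose_right (hκ : κ ≤ d) (U : Matrix (Fin d) (Fin κ) ℝ)
    {R : Matrix (Fin κ) (Fin κ) ℝ} (hR : R * Rᵀ = 1) :
    wHat E β x hκ U R * Rᵀ = U * matL E β x hκ := by
  rw [wHat, Matrix.mul_assoc, hR, Matrix.mul_one]

/-- Undoing R leaves UL, whose `j`-th column is the diagonal entry of L times a unit vector. -/
theorem col_wHat_eq_zero_iff (hκ : κ ≤ d) {U : Matrix (Fin d) (Fin κ) ℝ} (hU : Uᵀ * U = 1)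
    {R : Matrix (Fin κ) (Fin κ) ℝ} (hR : R * Rᵀ = 1) (j : Fin κ) :
    (wHat E β x hκ U R * Rᵀ).col j = 0 ↔ eig E x (Fin.castLE hκ j) ≤ cutOff E β := by
  rw [wHat_mul_transpose_right hκ U hR, ← matL_entry_eq_zero_iff (E := E) (β := β) hκ j]
  have hcol : (U * matL E β x hκ).col j
      = Real.sqrt (kEntry E β x hκ j - cutOff E β) • U.col j := by
    ext i
    rw [col_apply, matL, mul_diagonal, mul_comm]
    rfl
  have hne : U.col j ≠ 0 := by
    intro h
    have h1 := congrFun (congrFun hU j) j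
    rw [mul_apply, one_apply_eq] at h1
    have h2 : ∀ i, U i j = 0 := fun i => congrFun h i
    simp [h2] at h1
  rw [hcol, smul_eq_zero_iff_left hne]

/-- U has the left inverse Uᵀ and R is invertible, so the rank is that of the diagonal matrix L. -/
theorem rank_wHat (hκ : κ ≤ d) {U : Matrix (Fin d) (Fin κ) ℝ} (hU : Uᵀ * U = 1)
    {R : Matrix (Fin κ) (Fin κ) ℝ} (hR : R * Rᵀ = 1) :
    (wHat E β x hκ U R).rank
      = {j : Fin κ | cutOff E β < eig E x (Fin.castLE hκ j)}.ncard := by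
  have h1 : (wHat E β x hκ U R).rank = (matL E β x hκ).rank := by
    apply le_antisymm
    · exact (rank_mul_le_left _ _).trans (rank_mul_le_right _ _)
    · have hL : matL E β x hκ = Uᵀ * (wHat E β x hκ U R * Rᵀ) := by
        rw [wHat_mul_transpose_right hκ U hR, ← Matrix.mul_assoc, hU, Matrix.one_mul]
      conv_lhs => rw [hL]
      exact (rank_mul_le_right _ _).trans (rank_mul_le_left _ _)
  rw [h1, matL, rank_diagonal, ← Nat.card_eq_fintype_card, ← Nat.card_coe_set_eq]
  refine Nat.card_congr (Equiv.subtypeEquivRight fun j => ?_)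
  rw [Ne, matL_entry_eq_zero_iff, not_le]
  rfl

theorem posterior_collapse (hF2 : 0 < E.F2) (hβ : 0 < β) (hκ : κ ≤ d)
    (U : Matrix (Fin d) (Fin κ) ℝ) {R : Matrix (Fin κ) (Fin κ) ℝ} (hR : Rᵀ * R = 1)
    (h : ∀ j : Fin κ, eig E x (Fin.castLE hκ j) ≤ cutOff E β) :
    wHat E β x hκ U R = 0 ∧ sigmaHat E β x hκ R = 1 ∧ ∀ i, muHat E β x hκ U R i = 0 := by
  have hc := cutOff_pos E hF2 hβ
  have hL : matL E β x hκ = 0 := by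
    rw [matL, diagonal_eq_zero]
    ext j
    exact (matL_entry_eq_zero_iff hκ j).2 (h j)
  have hK : (matK E β x hκ)⁻¹ = (cutOff E β)⁻¹ • (1 : Matrix (Fin κ) (Fin κ) ℝ) := by
    have : matK E β x hκ = cutOff E β • (1 : Matrix (Fin κ) (Fin κ) ℝ) := by
      rw [matK, smul_one_eq_diagonal]
      congr 1
      ext j
      rw [kEntry_eq_max, max_eq_right (h j)]
    rw [this]
    refine inv_eq_right_inv ?_
    rw [smul_mul_smul_comm, mul_inv_cancel₀ hc.ne', one_smul, Matrix.one_mul]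
  refine ⟨by simp [wHat, hL], ?_, fun i => by simp [muHat, hL]⟩
  have hcc : β * E.φ / E.F2 = cutOff E β := by rw [cutOff, div_eq_mul_inv]; ring
  rw [sigmaHat, hK, Matrix.mul_smul, Matrix.smul_mul, Matrix.mul_one, hR, smul_smul, hcc,
    mul_inv_cancel₀ hc.ne', one_smul]

end Consequences

end BetaVAE

end

/-! ### The main theorem -/

theorem mainTheorem3 (E : EDF) (h0 : (0 : ℝ) ∈ E.paramSpace)
    (hF2pos : 0 < E.F2) (hF2le : E.F2 ≤ 1)
    (β : ℝ) (hβ : 0 < β)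
    (d κ N : ℕ) (hκ : κ ≤ d) (hN : 0 < N) (x : Fin N → Fin d → ℝ) :
    -- the approximate objective is what remains after optimizing the variational parameters
    (∀ (W : Matrix (Fin d) (Fin κ) ℝ) (b : Fin d → ℝ),
      IsGreatest ((fun p => jointObjective E β x W b p.1 p.2) '' varParams N κ)
        (approxObjective E β x W b)) ∧
    -- every choice of top eigenvectors and of an orthogonal matrix gives a maximizer
    (∃ U : Matrix (Fin d) (Fin κ) ℝ, IsTopEigenvectors E x hκ U) ∧
    (∀ U : Matrix (Fin d) (Fin κ) ℝ, IsTopEigenvectors E x hκ U →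
      ∀ R ∈ Matrix.orthogonalGroup (Fin κ) ℝ, ∀ (W : Matrix (Fin d) (Fin κ) ℝ) (b : Fin d → ℝ),
        approxObjective E β x W b ≤ approxObjective E β x (wHat E β x hκ U R) (bHat E x)) ∧
    -- every maximizer is of this form
    (∀ (W : Matrix (Fin d) (Fin κ) ℝ) (b : Fin d → ℝ),
      (∀ (W' : Matrix (Fin d) (Fin κ) ℝ) (b' : Fin d → ℝ),
        approxObjective E β x W' b' ≤ approxObjective E β x W b) →
      b = bHat E x ∧ ∃ U : Matrix (Fin d) (Fin κ) ℝ, IsTopEigenvectors E x hκ U ∧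
        ∃ R ∈ Matrix.specialOrthogonalGroup (Fin κ) ℝ, W = wHat E β x hκ U R) ∧
    -- consequences, for every maximizer
    (∀ U : Matrix (Fin d) (Fin κ) ℝ, IsTopEigenvectors E x hκ U →
      ∀ R ∈ Matrix.orthogonalGroup (Fin κ) ℝ,
        -- the unique optimal variational parameters
        (∀ p ∈ varParams N κ,
          IsMaxOn (fun q => jointObjective E β x (wHat E β x hκ U R) (bHat E x) q.1 q.2)
              (varParams N κ) p ↔
            ∀ i, p.1 i = muHat E β x hκ U R i ∧ p.2 i = sigmaHat E β x hκ R) ∧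
        (sigmaHat E β x hκ R).PosDef ∧
        (∀ i, muHat E β x hκ U R i = WithLp.toLp 2 ((1 / (β * E.φ)) •
          ((sigmaHat E β x hκ R * (wHat E β x hκ U R)ᵀ) *ᵥ (x i - xBar x)))) ∧
        -- auto-pruning
        (∀ j, (wHat E β x hκ U R * Rᵀ).col j = 0 ↔ eig E x (Fin.castLE hκ j) ≤ cutOff E β) ∧
        (wHat E β x hκ U R).rank = {j : Fin κ | cutOff E β < eig E x (Fin.castLE hκ j)}.ncard ∧
        -- posterior collapse
        ((∀ j : Fin κ, eig E x (Fin.castLE hκ j) ≤ cutOff E β) →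
          wHat E β x hκ U R = 0 ∧ sigmaHat E β x hκ R = 1 ∧ ∀ i, muHat E β x hκ U R i = 0)) := by
  refine ⟨fun W b => isGreatest_approxObjective E x hF2pos hβ hN W b, exists_isTopEigenvectors hκ,
    fun U hU R hR W b => ?_, fun W b h => eq_wHat_of_isMax hF2pos hβ hN hκ h,
    fun U hU R hR => ?_⟩
  · exact approxObjective_le_wHat hF2pos hβ hN hκ hU ((mem_orthogonalGroup_iff _ _).1 hR) W b
  have hR1 : R * Rᵀ = 1 := (mem_orthogonalGroup_iff _ _).1 hR
  have hR2 : Rᵀ * R = 1 := (mem_orthogonalGroup_iff' _ _).1 hR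
  refine ⟨fun p hp => ?_, posDef_sigmaHat hF2pos hβ hκ hR2,
    fun i => muHat_eq_smul hF2pos hβ hκ U hR2 i, fun j => col_wHat_eq_zero_iff hκ hU.1 hR1 j,
    rank_wHat hκ hU.1 hR1, posterior_collapse hF2pos hβ hκ U hR2⟩
  rw [isMaxOn_jointObjective_iff E x hF2pos hβ hN _ _ hp, sigmaHat_eq hF2pos hβ hκ hU.1 hR2]
  simp only [muHat_eq hF2pos hβ hN hκ hU.1 hR2]
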